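/- Let $i=\sqrt{-1}$ and $j=e^{2\pi i/3}$, let $F=\mathbb{Q}(i)$ or $F=\mathbb{Q}(j)$, and let $\mathbb{Q}(\theta)\subset\mathbb{C}$ be a totally real Galois number field of degree $n\ge 1$ whose discriminant $d_{\mathbb{Q}(\theta)}$ is coprime to the discriminant $d_F$ of $F$. Suppose that $K=F\,\mathbb{Q}(\theta)=F(\theta)$ is cyclic over $F$ with $\mathrm{Gal}(K/F)=\langle\sigma\rangle$, that $\gamma\in\mathcal{O}_F$ satisfies $|\gamma|=1$, and that the cyclic algebra $(K/F,\sigma,\gamma)=\bigoplus_{k=0}^{n-1}e^kK$ (with $le=e\sigma(l)$ for $l\in K$ and $e^n=\gamma$) is a division algebra. Let $\mathcal{I}\subseteq\mathcal{O}_K$ be an ideal with an $\mathcal{O}_F$-basis $\nu_1,\dots,\nu_n$, and let $R=(\sigma^{m}(\nu_k))_{0\le m<n,\,1\le k\le n}$ be the generator matrix of the complex lattice $\Lambda^c(\mathcal{I})=\{(x,\sigma(x),\dots,\sigma^{n-1}(x)):x\in\mathcal{I}\}$, whose volume $\mathrm{vol}(\Lambda^c(\mathcal{I}))=|\det R|^2$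 is the determinant of its Gram matrix. Suppose that for some real $c>0$ the matrix $\frac{1}{\sqrt c}R$ is unitary. The corresponding perfect code is $$\mathcal{C}_{\mathcal{I}}=\left\{\frac{1}{\sqrt c}\begin{pmatrix}x_0&x_1&\cdots&x_{n-1}\\ \gamma\sigma(x_{n-1})&\sigma(x_0)&\cdots&\sigma(x_{n-2})\\ \vdots&&&\vdots\\ \gamma\sigma^{n-1}(x_1)&\gamma\sigma^{n-1}(x_2)&\cdots&\sigma^{n-1}(x_0)\end{pmatrix}\;:\;x_0,\dots,x_{n-1}\in\mathcal{I}\right\}.$$ Then the minima $\delta_{\min}(\mathcal{C}_{\mathcal{I}})=\min_{0\ne X\in\mathcal{C}_{\mathcal{I}}}|\det X|^2$ and $\min_{0\ne x\in\mathcal{I}}N_{K/\mathbb{Q}}(x)$ exist, and $$\frac{N(\mathcal{I})}{\mathrm{vol}(\Lambda^c(\mathcal{I}))}=\frac{1}{d_{\mathbb{Q}(\theta)}}\;\le\;\delta_{\min}(\mathcal{C}_{\mathcal{I}})\;\le\;\frac{1}{\mathrm{vol}(\Lambda^c(\mathcal{I}))}\min_{0\ne x\in\mathcal{I}}N_{K/\mathbb{Q}}(x),$$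 where $N(\mathcal{I})=|\mathcal{O}_K/\mathcal{I}|$. In particular, for the $6\times 6$ code, that is, for $n=6$, $F=\mathbb{Q}(j)$, $\theta=\zeta_{28}+\zeta_{28}^{-1}=2\cos(\pi/14)$, $K=\mathbb{Q}(j,\theta)$, $\sigma$ any generator of $\mathrm{Gal}(K/F)$, $\gamma=-j$, $\mathcal{I}$ a prime ideal of $\mathcal{O}_K$ above $7$, and $c=14$, the minimum determinant $\delta_{\min}$ of the code displayed above exists and satisfies $$\frac{1}{2^6\cdot 7^5}\le\delta_{\min}\le\frac{1}{2^6\cdot 7^4}.$$ -/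

import Mathlib

open NumberField IntermediateField
open scoped Matrix

namespace PerfectCode

section CyclicAlgebra

variable {F K : Type*} [Field F] [Field K] [Algebra F K] {n : ℕ} [NeZero n]

/-- The matrix, in the basis `1, e, …, e ^ (n - 1)`, of left multiplication by
`x₀ + e x₁ + ⋯ + e ^ (n - 1) x_{n - 1}` in the cyclic algebra `(K/F, σ, γ)`, where `e ^ n = γ` and
`l e = e σ(l)` for `l ∈ K`. Rows and columns are numbered `0, …, n - 1`; the entry `(i, j)` is
`σ ^ j (x_{i - j})` if `j ≤ i` and `γ σ ^ j (x_{n + i - j})` if `j > i`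
(subtraction in `Fin n` is modulo `n`). -/
def leftMulMatrix (σ : K ≃ₐ[F] K) (γ : F) (x : Fin n → K) : Matrix (Fin n) (Fin n) K :=
  Matrix.of fun i j =>
    (if j ≤ i then 1 else algebraMap F K γ) * (σ ^ (j : ℕ)) (x (i - j))

/-- The matrices of left multiplication are closed under products: `λ_x λ_y = λ_{x y}`. -/
theorem leftMulMatrix_mul (σ : K ≃ₐ[F] K) (hσ : σ ^ n = 1) (γ : F) (x y : Fin n → K) :
    leftMulMatrix σ γ (leftMulMatrix σ γ x *ᵥ y) = leftMulMatrix σ γ x * leftMulMatrix σ γ y := by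
  ext i k
  simp only [leftMulMatrix, Matrix.mul_apply, Matrix.of_apply, Matrix.mulVec, dotProduct,
    map_sum, Finset.mul_sum]
  refine Fintype.sum_equiv (Equiv.addRight k) _ _ fun m => ?_
  rw [show (Equiv.addRight k) m = m + k from rfl]
  simp only [add_sub_cancel_right, map_mul]
  have h1 : i - k - m = i - (m + k) := by abel
  have h2 : ((m + k : Fin n) : ℕ) = if (m : ℕ) + k < n then (m : ℕ) + k else m + k - n := by
    rw [Fin.val_add]
    split_ifs with h
    · exact Nat.mod_eq_of_lt h
    · rw [Nat.mod_eq_sub_mod (by omega), Nat.mod_eq_of_lt (by omega)]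
  have h3 : σ ^ ((k : ℕ) + m) = σ ^ ((m + k : Fin n) : ℕ) := by
    rw [h2]
    split_ifs with h
    · rw [add_comm]
    · have : (k : ℕ) + m = (m + k - n) + n := by omega
      rw [this, pow_add, hσ, mul_one]
  have h4 : ((i - k : Fin n) : ℕ) = if (k : ℕ) ≤ i then (i : ℕ) - k else i + n - k := by
    rw [Fin.val_sub]
    split_ifs with h
    · rw [show n - (k : ℕ) + i = (i - k) + n by omega, Nat.add_mod_right,
        Nat.mod_eq_of_lt (by omega)]
    · rw [Nat.mod_eq_of_lt (by omega)]; omega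
  have h5 : (σ ^ (k : ℕ)) ((σ ^ (m : ℕ)) (x (i - k - m)))
      = (σ ^ ((m + k : Fin n) : ℕ)) (x (i - (m + k))) := by
    rw [← h3, pow_add, h1]; rfl
  rw [h5]
  have h6 : ((if k ≤ i then 1 else algebraMap F K γ)
        * (σ ^ (k : ℕ)) (if m ≤ i - k then 1 else algebraMap F K γ))
      = (if m + k ≤ i then 1 else algebraMap F K γ)
        * (if k ≤ m + k then 1 else algebraMap F K γ) := by
    simp only [Fin.le_def, h2, h4, apply_ite (σ ^ (k : ℕ)), map_one, AlgEquiv.commutes]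
    split_ifs <;> first | omega | simp
  linear_combination ((σ ^ ((m + k : Fin n) : ℕ)) (x (i - (m + k))) * (σ ^ (k : ℕ)) (y m)) * h6

/-- The cyclic algebra `(K/F, σ, γ) = K ⊕ e K ⊕ ⋯ ⊕ e ^ (n - 1) K`, realised by its faithful
representation `x ↦ λ_x` by matrices of left multiplication. -/
def cyclicAlgebra (σ : K ≃ₐ[F] K) (γ : F) (hσ : σ ^ n = 1) :
    Subalgebra F (Matrix (Fin n) (Fin n) K) where
  carrier := Set.range (leftMulMatrix σ γ)
  mul_mem' := by
    rintro _ _ ⟨x, rfl⟩ ⟨y, rfl⟩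
    exact ⟨_, leftMulMatrix_mul σ hσ γ x y⟩
  add_mem' := by
    rintro _ _ ⟨x, rfl⟩ ⟨y, rfl⟩
    exact ⟨x + y, by ext i j; simp [leftMulMatrix, mul_add]⟩
  algebraMap_mem' r := by
    refine ⟨Pi.single 0 (algebraMap F K r), ?_⟩
    ext i j
    by_cases h : i = j
    · subst h
      simpa [leftMulMatrix, Matrix.algebraMap_matrix_apply, -AlgEquiv.commutes]
        using (σ ^ (i : ℕ)).commutes r
    · simp [leftMulMatrix, Matrix.algebraMap_matrix_apply, h, Pi.single_apply, sub_eq_zero]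

end CyclicAlgebra

section Code

variable {F : IntermediateField ℚ ℂ} {K : IntermediateField F ℂ} {n : ℕ} [NeZero n]

/-- The infinite code `(1 / √c) C_I`: the complex matrices
`(1 / √c) [x₀ x₁ … x_{n-1}; γ σ(x_{n-1}) σ(x₀) … σ(x_{n-2}); … ;
γ σ^{n-1}(x₁) γ σ^{n-1}(x₂) … σ^{n-1}(x₀)]` with all `x_l` in the ideal `I`; they are the transposes
of the matrices of left multiplication. -/
noncomputable def infiniteCode (n : ℕ) [NeZero n] (σ : K ≃ₐ[F] K) (γ : F) (I : Ideal (𝓞 K))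
    (c : ℝ) : Set (Matrix (Fin n) (Fin n) ℂ) :=
  {X | ∃ x : Fin n → I,
    X = (((√c)⁻¹ : ℝ) : ℂ) •
      ((leftMulMatrix σ γ fun l => ((x l : 𝓞 K) : K)).map (algebraMap K ℂ))ᵀ}

/-- `δ` is the minimum determinant of the code `C`, the minimum of `|det X| ^ 2` over the nonzero
codewords `X` (in particular this minimum is attained). -/
def IsMinDet (C : Set (Matrix (Fin n) (Fin n) ℂ)) (δ : ℝ) : Prop :=
  IsLeast {r : ℝ | ∃ X ∈ C, X ≠ 0 ∧ r = ‖X.det‖ ^ 2} δ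

/-- The generator matrix of the complex algebraic lattice `Λ^c(I)`: the `k`-th column is the image
`(ν_k, σ(ν_k), …, σ^{n-1}(ν_k))` of the `k`-th element of an `𝓞 F`-basis of `I` under the complex
embedding. -/
noncomputable def generatorMatrix (σ : K ≃ₐ[F] K) {I : Ideal (𝓞 K)} (ν : Module.Basis (Fin n) (𝓞 F) I) :
    Matrix (Fin n) (Fin n) ℂ :=
  Matrix.of fun m k => algebraMap K ℂ ((σ ^ (m : ℕ)) ((ν k : 𝓞 K) : K))

/-- The volume of the complex lattice `Λ^c(I)`, the determinant `|det R| ^ 2` of its Gram matrix.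
It is the factor by which the real lattice `Λ(I)` exceeds the lattice `(𝓞 F) ^ n` in volume, and
does not depend on the basis. -/
noncomputable def complexLatticeVol (σ : K ≃ₐ[F] K) {I : Ideal (𝓞 K)}
    (ν : Module.Basis (Fin n) (𝓞 F) I) : ℝ :=
  ‖(generatorMatrix σ ν).det‖ ^ 2

/-- `m` is the minimum of `N_{K/ℚ}(x)` over the nonzero elements `x` of the ideal `I`. -/
def IsMinNorm (I : Ideal (𝓞 K)) (m : ℝ) : Prop :=
  IsLeast {r : ℝ | ∃ x ∈ I, x ≠ 0 ∧ r = ((Algebra.norm ℚ (x : K) : ℚ) : ℝ)} m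

end Code

/-- The primitive third root of unity `j = exp (2πi / 3)`. -/
noncomputable def zetaThree : ℂ := Complex.exp (2 * Real.pi * Complex.I / 3)

/-- `θ = ζ₂₈ + ζ₂₈⁻¹ = 2 cos (π / 14)`. -/
noncomputable def thetaSix : ℂ := ((2 * Real.cos (Real.pi / 14) : ℝ) : ℂ)

/-- The base field `ℚ(j)`. -/
noncomputable abbrev baseSix : IntermediateField ℚ ℂ := ℚ⟮zetaThree⟯

/-- The field `ℚ(j, θ)` with `θ = 2 cos (π / 14)`, as an extension of `ℚ(j)`. -/
noncomputable abbrev fieldSix : IntermediateField baseSix ℂ := baseSix⟮thetaSix⟯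

/-- The element `γ = -j` of `ℚ(j)`. -/
noncomputable def gammaSix : baseSix := -AdjoinSimple.gen ℚ zetaThree

/-- The data of a perfect `n × n` code over the cyclic division algebra `(K/F, σ, γ)`, `γ ∈ 𝓞 F`,
`K = F ℚ(θ)`: the code is `infiniteCode n σ γ I c`, and it uses the symbols
`u_{l,k} ∈ 𝓞 F` through `x_l = ∑ k, u_{l,k} ν_k`. -/
structure IsPerfectCode {F : IntermediateField ℚ ℂ} [NumberField F] (θ : ℂ) [NumberField ℚ⟮θ⟯]
    {K : IntermediateField F ℂ} {n : ℕ} [NeZero n] (σ : K ≃ₐ[F] K) (γ : F) {I : Ideal (𝓞 K)}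
    (ν : Module.Basis (Fin n) (𝓞 F) I) (c : ℝ) : Prop where
  /-- QAM symbols (`F = ℚ(i)`) or HEX symbols (`F = ℚ(j)`). -/
  base : F = ℚ⟮Complex.I⟯ ∨ F = ℚ⟮zetaThree⟯
  totallyReal : IsTotallyReal ℚ⟮θ⟯
  galois : IsGalois ℚ ℚ⟮θ⟯
  degree : Module.finrank ℚ ℚ⟮θ⟯ = n
  coprime : IsCoprime (discr F) (discr ℚ⟮θ⟯)
  compositum : K = F⟮θ⟯
  /-- `K/F` is cyclic of degree `n` with Galois group generated by `σ`. -/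
  cyclic : IsGalois F K ∧ ∀ τ : K ≃ₐ[F] K, τ ∈ Subgroup.zpowers σ
  pow_eq_one : σ ^ n = 1
  integral : IsIntegral ℤ γ
  /-- Uniform average transmitted energy per antenna. -/
  energy : ‖(γ : ℂ)‖ = 1
  /-- The cyclic algebra is a division algebra. -/
  division : ∀ a : cyclicAlgebra σ γ pow_eq_one, a ≠ 0 → IsUnit a
  pos : 0 < c
  /-- Cubic shaping: the matrix encoding the symbols into each layer is unitary. -/
  shaping : (((√c)⁻¹ : ℝ) : ℂ) • generatorMatrix σ ν ∈ Matrix.unitaryGroup (Fin n) ℂ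

end PerfectCode

/-! A codeword has determinant `c ^ (-n/2)` times the reduced norm of `x` (the determinant of left
multiplication). Conjugation by `e` shows that this reduced norm is fixed by `σ`, hence lies in `F`;
it is integral because `γ` is. Column `j` of the matrix has entries in `σ^j(I)`, so the reduced norm
`d` lies in the product of the conjugates of `I`. Taking absolute norms, `N(I)^n` divides
`N_{F/ℚ}(d)^n`, hence `N(I)` divides `N_{F/ℚ}(d) = |d|^2`. So the values `|det X|^2` are natural
numbers divided by `c^n`: the minimum exists, and it is at least `N(I)/c^n`, as a division algebra
has nonzero reduced norms on nonzero elements. The codeword with a single coordinate `x₀ = y` has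
reduced norm `N_{K/F}(y)`, which gives the upper bound (`exists_isMinDet`).

Unitarity gives `c^n = vol`. Since the discriminants are coprime, an integral basis of `ℚ(θ)` is an
`𝓞 F`-basis of `𝓞 K`, and passing to a basis of `I` multiplies the squared determinant by `N(I)`;
hence `vol = N(I) d_{ℚ(θ)}` (`absNorm_mul_discr_eq_vol`).

For the `6 × 6` code, `exists_isMinDet` is applied directly with `c = 14`. The relation `θ^6 = 7
(θ^2 - 1)^2`, with `θ^2 - 1` a unit, and `7 = (3 + j)(2 - j)` make `P` totally ramified over `F`
with residue field of `7` elements. So `σ` acts trivially modulo `P`, while `-j` becomes a primitive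
sixth root of unity, whose sixth roots have degree at least `6`. Reduction modulo `P` then gives the
division property (`prime_above_seven`). -/

namespace PerfectCode

/-! ### The reduced norm takes values in the base field -/

section Determinant

variable {F K : Type*} [Field F] [Field K] [Algebra F K] {n : ℕ}

theorem leftMulMatrix_map (σ : K ≃ₐ[F] K) (γ : F) (x : Fin n → K) :
    (leftMulMatrix σ γ x).map σ = leftMulMatrix σ γ fun i => σ (x i) := by
  ext i j
  have h : σ ((σ ^ (j : ℕ)) (x (i - j))) = (σ ^ (j : ℕ)) (σ (x (i - j))) := by
    rw [← AlgEquiv.mul_apply, ← AlgEquiv.mul_apply, ← pow_succ, ← pow_succ']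
  simp only [leftMulMatrix, Matrix.map_apply, Matrix.of_apply, map_mul, h, apply_ite σ, map_one,
    AlgEquiv.commutes]

/-- This is `λ_{x l} = λ_x λ_l`: scalars of `K` act on the right of the coordinates. It serves to
clear denominators. -/
theorem leftMulMatrix_smul (σ : K ≃ₐ[F] K) (γ : F) (x : Fin n → K) (l : K) :
    (leftMulMatrix σ γ fun i => l * x i) =
      leftMulMatrix σ γ x * Matrix.diagonal fun j : Fin n => (σ ^ (j : ℕ)) l := by
  ext i j
  rw [Matrix.mul_diagonal]
  simp only [leftMulMatrix, Matrix.of_apply, map_mul]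
  ring

variable [NeZero n]

theorem leftMulMatrix_single_zero (σ : K ≃ₐ[F] K) (γ : F) (a : K) :
    leftMulMatrix σ γ (Pi.single (0 : Fin n) a) =
      Matrix.diagonal fun j : Fin n => (σ ^ (j : ℕ)) a := by
  ext i j
  by_cases h : i = j
  · subst h; simp [leftMulMatrix]
  · simp [leftMulMatrix, h, sub_eq_zero]

theorem leftMulMatrix_apply_ne_zero {σ : K ≃ₐ[F] K} {γ : F} {x : Fin n → K} (hx : x ≠ 0) :
    leftMulMatrix σ γ x ≠ 0 := by
  contrapose! hx
  ext i
  simpa [leftMulMatrix] using congrFun (congrFun hx i) 0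

/-- The reduced norm is fixed by `σ`, because `λ_{σ(x)} = λ_e⁻¹ λ_x λ_e`. -/
theorem apply_det_leftMulMatrix {σ : K ≃ₐ[F] K} (hσ : σ ^ n = 1) {γ : F} (hγ : γ ≠ 0)
    (x : Fin n → K) : σ (leftMulMatrix σ γ x).det = (leftMulMatrix σ γ x).det := by
  -- For `n = 1` the index `1` of `e` is `0` in `Fin n`, so this case is separate; there `σ = 1`.
  rcases Nat.lt_or_ge n 2 with hn | hn
  · have h1 : n = 1 := by have := NeZero.pos n; omega
    subst h1
    rw [pow_one] at hσ
    simp [hσ]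
  have h0 : σ (leftMulMatrix σ γ x).det = ((leftMulMatrix σ γ x).map σ).det := by
    simpa using AlgHom.map_det σ.toAlgHom (leftMulMatrix σ γ x)
  have hv1 : ((1 : Fin n) : ℕ) = 1 := Fin.val_one' n ▸ Nat.mod_eq_of_lt hn
  have hle (i : Fin n) : (i - 1 ≤ i) ↔ (1 ≤ i) := by
    rw [Fin.le_def, Fin.le_def, hv1, Fin.val_sub, hv1]
    have := i.2
    rcases Nat.eq_zero_or_pos (i : ℕ) with h | h
    · rw [h, add_zero, Nat.mod_eq_of_lt (by omega)]; omega
    · rw [show n - 1 + (i : ℕ) = (i - 1) + n by omega, Nat.add_mod_right,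
        Nat.mod_eq_of_lt (by omega)]
      omega
  -- These are the coordinates of `e` and of `e⁻¹ = e^(n-1) γ⁻¹`; the index `-1` is `n - 1` in `Fin
  -- n`. The next identity is `x e = e σ(x)`.
  set e : Fin n → K := Pi.single 1 1 with he
  set f : Fin n → K := Pi.single (-1) (algebraMap F K γ)⁻¹ with hf
  have hγ' : algebraMap F K γ ≠ 0 := by simpa using hγ
  have h1 : leftMulMatrix σ γ x * leftMulMatrix σ γ e =
      leftMulMatrix σ γ e * (leftMulMatrix σ γ x).map σ := by
    rw [leftMulMatrix_map, ← leftMulMatrix_mul σ hσ, ← leftMulMatrix_mul σ hσ]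
    congr 1
    ext i
    have : ((leftMulMatrix σ γ e) *ᵥ fun i => σ (x i)) i =
        (leftMulMatrix σ γ e) i (i - 1) * σ (x (i - 1)) := by
      refine Fintype.sum_eq_single (i - 1) fun j hj => ?_
      have : i - j ≠ 1 := fun h => hj (by rw [← h]; abel)
      simp [leftMulMatrix, he, this]
    rw [this, he, Matrix.mulVec_single_one]
    simp [leftMulMatrix, hle, Nat.mod_eq_of_lt hn]
  have h2 : leftMulMatrix σ γ e * leftMulMatrix σ γ f = 1 := by
    rw [← leftMulMatrix_mul σ hσ]
    have : leftMulMatrix σ γ e *ᵥ f = Pi.single 0 1 := by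
      ext i
      rw [hf, Matrix.mulVec_single]
      by_cases hi : i = 0
      · subst hi
        have : ¬ ((-1 : Fin n) ≤ 0) := by
          intro h
          have h' : (-1 : Fin n) = 0 := Fin.ext (Nat.le_zero.mp (by simpa using Fin.le_def.mp h))
          rw [neg_eq_zero] at h'
          rw [h'] at hv1
          simp at hv1
        simp [leftMulMatrix, he, this, hγ']
      · simp [leftMulMatrix, he, hi, Pi.single_apply]
    rw [this, leftMulMatrix_single_zero]
    simp
  have h3 : (leftMulMatrix σ γ e).det ≠ 0 := by
    intro h
    simpa [h] using congrArg Matrix.det h2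
  have h4 := congrArg Matrix.det h1
  rw [Matrix.det_mul, Matrix.det_mul, mul_comm] at h4
  rw [h0, mul_left_cancel₀ h3 h4]

section Galois

variable [FiniteDimensional F K] [IsGalois F K] {σ : K ≃ₐ[F] K}

theorem bijective_pow_of_generator (hn : Module.finrank F K = n) (hσ : σ ^ n = 1)
    (hgen : ∀ τ : K ≃ₐ[F] K, τ ∈ Subgroup.zpowers σ) :
    Function.Bijective fun j : Fin n => σ ^ (j : ℕ) := by
  rw [Fintype.bijective_iff_surjective_and_card]
  refine ⟨fun τ => ?_, ?_⟩
  · have hfin : IsOfFinOrder σ := isOfFinOrder_of_finite σ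
    obtain ⟨k, rfl⟩ := hfin.mem_powers_iff_mem_zpowers.mpr (hgen τ)
    refine ⟨⟨k % n, Nat.mod_lt _ (NeZero.pos n)⟩, ?_⟩
    change σ ^ (k % n) = σ ^ k
    conv_rhs => rw [← Nat.div_add_mod k n, pow_add, pow_mul, hσ, one_pow, one_mul]
  · rw [Fintype.card_fin, ← Nat.card_eq_fintype_card, IsGalois.card_aut_eq_finrank, hn]

theorem prod_pow_apply_eq_norm (hn : Module.finrank F K = n) (hσ : σ ^ n = 1)
    (hgen : ∀ τ : K ≃ₐ[F] K, τ ∈ Subgroup.zpowers σ) (a : K) :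
    ∏ j : Fin n, (σ ^ (j : ℕ)) a = algebraMap F K (Algebra.norm F a) := by
  rw [Algebra.norm_eq_prod_automorphisms]
  exact (bijective_pow_of_generator hn hσ hgen).prod_comp fun τ : K ≃ₐ[F] K => τ a

theorem exists_algebraMap_eq_det_leftMulMatrix (hσ : σ ^ n = 1)
    (hgen : ∀ τ : K ≃ₐ[F] K, τ ∈ Subgroup.zpowers σ) {γ : F} (hγ : γ ≠ 0) (x : Fin n → K) :
    ∃ d : F, algebraMap F K d = (leftMulMatrix σ γ x).det := by
  have hfix : ∀ τ : K ≃ₐ[F] K, τ (leftMulMatrix σ γ x).det = (leftMulMatrix σ γ x).det := by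
    intro τ
    obtain ⟨k, rfl⟩ := Subgroup.mem_zpowers_iff.mp (hgen τ)
    have : σ ^ k ∈ MulAction.stabilizer (K ≃ₐ[F] K) (leftMulMatrix σ γ x).det :=
      Subgroup.zpow_mem _ (apply_det_leftMulMatrix hσ hγ x) k
    exact this
  have := (IsGalois.mem_bot_iff_fixed (F := F) (E := K) _).mpr hfix
  exact IntermediateField.mem_bot.mp this

end Galois

end Determinant

/-! ### Norms from imaginary quadratic fields -/

section ImaginaryQuadratic

theorem finrank_adjoin_eq_two {z : ℂ} (hz : z.im ≠ 0) {a b : ℚ} (h : z ^ 2 + a * z + b = 0) :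
    Module.finrank ℚ ℚ⟮z⟯ = 2 := by
  have hm : (Polynomial.X ^ 2 + Polynomial.C a * Polynomial.X + Polynomial.C b :
      Polynomial ℚ).Monic := by
    monicity!
  have hdeg : (Polynomial.X ^ 2 + Polynomial.C a * Polynomial.X + Polynomial.C b :
      Polynomial ℚ).natDegree = 2 := by
    compute_degree!
  have h0 : Polynomial.aeval z
      (Polynomial.X ^ 2 + Polynomial.C a * Polynomial.X + Polynomial.C b : Polynomial ℚ) = 0 := by
    simpa using h
  have hint : IsIntegral ℚ z := ⟨_, hm, by simpa [Polynomial.aeval_def] using h0⟩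
  rw [adjoin.finrank hint]
  refine le_antisymm (hdeg ▸ Polynomial.natDegree_le_natDegree (minpoly.min ℚ z hm h0)) ?_
  rw [minpoly.two_le_natDegree_iff hint]
  rintro ⟨q, rfl⟩
  simp at hz

/-- The norm of an imaginary quadratic field is the square of the absolute value. -/
theorem norm_adjoin_eq_sq_norm {z : ℂ} (hz : z.im ≠ 0) {a b : ℚ} (h : z ^ 2 + a * z + b = 0)
    (y : ℚ⟮z⟯) : ((Algebra.norm ℚ y : ℚ) : ℝ) = ‖(y : ℂ)‖ ^ 2 := by
  have hrank := finrank_adjoin_eq_two hz h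
  have : FiniteDimensional ℚ ℚ⟮z⟯ := Module.finite_of_finrank_pos (by omega)
  let f : ℚ⟮z⟯ →ₐ[ℚ] ℂ := ℚ⟮z⟯.val
  let g : ℚ⟮z⟯ →ₐ[ℚ] ℂ := (Complex.conjAe.toAlgHom.restrictScalars ℚ).comp f
  have hfg : f ≠ g := by
    intro hfg
    have := DFunLike.congr_fun hfg (AdjoinSimple.gen ℚ z)
    exact hz (Complex.conj_eq_iff_im.mp this.symm)
  classical
  have huniv : ({f, g} : Finset (ℚ⟮z⟯ →ₐ[ℚ] ℂ)) = Finset.univ := by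
    rw [← Finset.card_eq_iff_eq_univ, Finset.card_pair hfg, AlgHom.card, hrank]
  have hprod := Algebra.norm_eq_prod_embeddings ℚ ℂ y
  rw [← huniv, Finset.prod_pair hfg] at hprod
  have h2 : f y * g y = ((‖(y : ℂ)‖ ^ 2 : ℝ) : ℂ) := by
    rw [Complex.ofReal_pow]
    exact Complex.mul_conj' (y : ℂ)
  rw [h2] at hprod
  apply Complex.ofReal_injective
  rw [← hprod]
  simp

end ImaginaryQuadratic

theorem absNorm_map_ringEquiv {R S : Type*} [CommRing R] [IsDedekindDomain R] [Module.Free ℤ R]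
    [CommRing S] [IsDedekindDomain S] [Module.Free ℤ S] (e : R ≃+* S) (I : Ideal R) :
    Ideal.absNorm (I.map (e : R →+* S)) = Ideal.absNorm I := by
  rw [Ideal.absNorm_apply, Ideal.absNorm_apply, Submodule.cardQuot_apply, Submodule.cardQuot_apply]
  exact (Nat.card_congr (Ideal.quotientEquiv I _ e rfl).toEquiv).symm

/-! ### Integrality and divisibility of reduced norms -/

section Integrality

variable {F K : Type*} [Field F] [Field K] [Algebra F K] {n : ℕ} {σ : K ≃ₐ[F] K} {γ : F}
  {I : Ideal (𝓞 K)}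

/-- The matrix of left multiplication by an element with integral coordinates. -/
noncomputable def integralLeftMulMatrix (σ : K ≃ₐ[F] K) (g : 𝓞 F) (x : Fin n → 𝓞 K) :
    Matrix (Fin n) (Fin n) (𝓞 K) :=
  Matrix.of fun i j => (if j ≤ i then 1 else algebraMap (𝓞 F) (𝓞 K) g) *
    RingOfIntegers.mapRingEquiv (σ ^ (j : ℕ)).toRingEquiv (x (i - j))

theorem coe_det_integralLeftMulMatrix (σ : K ≃ₐ[F] K) (g : 𝓞 F) (x : Fin n → 𝓞 K) :
    ((integralLeftMulMatrix σ g x).det : K) = (leftMulMatrix σ (g : F) fun l => (x l : K)).det := by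
  refine (RingHom.map_det (algebraMap (𝓞 K) K) _).trans ?_
  congr 1
  ext i j
  simp only [leftMulMatrix, integralLeftMulMatrix, Matrix.of_apply, RingHom.mapMatrix_apply,
    Matrix.map_apply, map_mul, apply_ite (algebraMap (𝓞 K) K), map_one]
  rfl

/-- The reduced norm of an element with coordinates in `I` lies in the product of the conjugates of
`I`. -/
theorem det_integralLeftMulMatrix_mem_prod (σ : K ≃ₐ[F] K) (g : 𝓞 F) (x : Fin n → I) :
    (integralLeftMulMatrix σ g fun l => (x l : 𝓞 K)).det ∈
      ∏ j : Fin n, I.map (RingOfIntegers.mapRingEquiv (σ ^ (j : ℕ)).toRingEquiv : 𝓞 K →+* 𝓞 K) := by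
  rw [Matrix.det_apply]
  refine Ideal.sum_mem _ fun τ _ => ?_
  rw [Units.smul_def]
  refine zsmul_mem (Ideal.prod_mem_prod fun j _ => ?_) _
  exact Ideal.mul_mem_left _ _ (Ideal.mem_map_of_mem _ (x _).2)

variable [NumberField F] {φ : K →+* ℂ}

theorem natAbs_norm_eq_sq_norm (hF : ∀ y : F, ((Algebra.norm ℚ y : ℚ) : ℝ) = ‖φ (algebraMap F K y)‖ ^ 2)
    (d : 𝓞 F) : ((Algebra.norm ℤ d).natAbs : ℝ) = ‖φ (algebraMap F K d)‖ ^ 2 := by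
  have h := hF d
  rw [← Algebra.coe_norm_int, Rat.cast_intCast] at h
  rw [← h, Nat.cast_natAbs, Int.cast_abs, abs_of_nonneg (h ▸ by positivity)]

variable [NumberField K]

theorem norm_eq_sq_norm_norm (hF : ∀ y : F, ((Algebra.norm ℚ y : ℚ) : ℝ) = ‖φ (algebraMap F K y)‖ ^ 2)
    (x : K) : ((Algebra.norm ℚ x : ℚ) : ℝ) = ‖φ (algebraMap F K (Algebra.norm F x))‖ ^ 2 := by
  rw [← hF, Algebra.norm_norm]

theorem norm_algebraMap_eq_pow (d : 𝓞 F) :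
    Algebra.norm ℤ (algebraMap (𝓞 F) (𝓞 K) d) = Algebra.norm ℤ d ^ Module.finrank F K := by
  have : ((Algebra.norm ℤ (algebraMap (𝓞 F) (𝓞 K) d) : ℤ) : ℚ) =
      ((Algebra.norm ℤ d ^ Module.finrank F K : ℤ) : ℚ) := by
    rw [Algebra.coe_norm_int, Int.cast_pow, Algebra.coe_norm_int, ← map_pow,
      ← Algebra.norm_algebraMap (S := K), Algebra.norm_norm]
    rfl
  exact_mod_cast this

/-- The reduced norm descends to some `d ∈ 𝓞 F`, and `N` is the absolute value of its norm to `ℤ`.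
-/
theorem exists_nat_dvd_sq_norm_det [NeZero n] [IsGalois F K]
    (hF : ∀ y : F, ((Algebra.norm ℚ y : ℚ) : ℝ) = ‖φ (algebraMap F K y)‖ ^ 2)
    (hn : Module.finrank F K = n) (hσ : σ ^ n = 1)
    (hgen : ∀ τ : K ≃ₐ[F] K, τ ∈ Subgroup.zpowers σ) (hγ : IsIntegral ℤ γ) (hγ0 : γ ≠ 0)
    (x : Fin n → I) :
    ∃ N : ℕ, (N : ℝ) =
        ‖φ (leftMulMatrix σ γ fun l => ((x l : 𝓞 K) : K)).det‖ ^ 2 ∧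
      Ideal.absNorm I ∣ N := by
  obtain ⟨d, hd⟩ := exists_algebraMap_eq_det_leftMulMatrix hσ hgen hγ0
    fun l => ((x l : 𝓞 K) : K)
  have hD := coe_det_integralLeftMulMatrix σ ⟨γ, hγ⟩ fun l => (x l : 𝓞 K)
  have hint : IsIntegral ℤ d := by
    have := (integralLeftMulMatrix σ ⟨γ, hγ⟩ fun l => (x l : 𝓞 K)).det.isIntegral_coe
    exact (isIntegral_algHom_iff (IsScalarTower.toAlgHom ℤ F K)
      (algebraMap F K).injective).mp (hd.trans hD.symm ▸ this)
  let d' : 𝓞 F := ⟨d, hint⟩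
  refine ⟨(Algebra.norm ℤ d').natAbs, ?_, ?_⟩
  · rw [natAbs_norm_eq_sq_norm hF, ← hd]
    rfl
  · have hmem := det_integralLeftMulMatrix_mem_prod σ ⟨γ, hγ⟩ x
    rw [show (integralLeftMulMatrix σ ⟨γ, hγ⟩ fun l => (x l : 𝓞 K)).det =
      algebraMap (𝓞 F) (𝓞 K) d' from RingOfIntegers.coe_injective (hD.trans hd.symm)] at hmem
    -- All `n` conjugates of `I` have the norm of `I`, and `N_{K/ℚ}(d) = N_{F/ℚ}(d)^n`; the common
    -- exponent `n` cancels.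
    have h1 := Ideal.absNorm_dvd_absNorm_of_le ((Ideal.span_singleton_le_iff_mem _).mpr hmem)
    rw [map_prod, Finset.prod_congr rfl fun j _ => absNorm_map_ringEquiv _ I,
      Finset.prod_const, Finset.card_univ, Fintype.card_fin, Ideal.absNorm_span_singleton] at h1
    rw [norm_algebraMap_eq_pow, hn, Int.natAbs_pow] at h1
    exact (Nat.pow_dvd_pow_iff (NeZero.ne n)).mp h1

theorem exists_isLeast_norm (hF : ∀ y : F, ((Algebra.norm ℚ y : ℚ) : ℝ) = ‖φ (algebraMap F K y)‖ ^ 2)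
    (hI : I ≠ ⊥) : ∃ m : ℝ,
    IsLeast {r : ℝ | ∃ x ∈ I, x ≠ 0 ∧ r = ((Algebra.norm ℚ (x : K) : ℚ) : ℝ)} m := by
  let S : Set ℕ := {N | ∃ x ∈ I, x ≠ 0 ∧ N = (Algebra.norm ℤ x).natAbs}
  have hval (x : 𝓞 K) :
      ((Algebra.norm ℤ x).natAbs : ℝ) = ((Algebra.norm ℚ (x : K) : ℚ) : ℝ) := by
    have h := norm_eq_sq_norm_norm hF (x : K)
    rw [← Algebra.coe_norm_int, Rat.cast_intCast] at h
    rw [← Algebra.coe_norm_int, Rat.cast_intCast, Nat.cast_natAbs, Int.cast_abs,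
      abs_of_nonneg (h ▸ by positivity)]
  have hS : S.Nonempty := by
    obtain ⟨y, hy, hy0⟩ := Submodule.exists_mem_ne_zero_of_ne_bot hI
    exact ⟨(Algebra.norm ℤ y).natAbs, y, hy, hy0, rfl⟩
  obtain ⟨x₀, hx₀, hx₀', hN₀⟩ := Nat.sInf_mem hS
  refine ⟨(sInf S : ℕ), ⟨x₀, hx₀, hx₀', ?_⟩, ?_⟩
  · rw [hN₀, hval]
  · rintro _ ⟨x, hx, hx0, rfl⟩
    rw [← hval]
    exact_mod_cast Nat.sInf_le (s := S) ⟨x, hx, hx0, rfl⟩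

end Integrality

/-! ### Existence and bounds of the minimum determinant -/

section Code

variable {F : IntermediateField ℚ ℂ} {K : IntermediateField F ℂ} {n : ℕ} {σ : K ≃ₐ[F] K} {γ : F}
  {I : Ideal (𝓞 K)} {c : ℝ}

theorem sq_norm_det_codeword (hc : 0 < c) (M : Matrix (Fin n) (Fin n) K) :
    ‖((((√c)⁻¹ : ℝ) : ℂ) • (M.map (algebraMap K ℂ))ᵀ).det‖ ^ 2 =
      ‖algebraMap K ℂ M.det‖ ^ 2 / c ^ n := by
  rw [Matrix.det_smul, Matrix.det_transpose, RingHom.map_det, norm_mul, norm_pow, mul_pow,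
    Fintype.card_fin, Complex.norm_real, ← pow_mul, mul_comm n 2, pow_mul, Real.norm_eq_abs,
    sq_abs, inv_pow, Real.sq_sqrt hc.le, inv_pow, div_eq_inv_mul]
  rfl

/-- Well-ordering of the natural numbers `|det λ_x|^2` provides the minimum. Only nonvanishing of
the determinants enters, with no condition on the shaping constant beyond `c > 0`. -/
theorem exists_isMinDet [NumberField F] [NumberField K] [NeZero n] [IsGalois F K]
    (hF : ∀ y : F, ((Algebra.norm ℚ y : ℚ) : ℝ) = ‖(y : ℂ)‖ ^ 2)
    (hn : Module.finrank F K = n) (hσ : σ ^ n = 1)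
    (hgen : ∀ τ : K ≃ₐ[F] K, τ ∈ Subgroup.zpowers σ) (hγ : IsIntegral ℤ γ) (hγ0 : γ ≠ 0)
    (hI : I ≠ ⊥) (hc : 0 < c)
    (hdiv : ∀ x : Fin n → K, x ≠ 0 → (leftMulMatrix σ γ x).det ≠ 0) :
    ∃ δ : ℝ, IsMinDet (infiniteCode n σ γ I c) δ ∧ (Ideal.absNorm I : ℝ) / c ^ n ≤ δ ∧
      ∀ x ∈ I, x ≠ 0 → δ ≤ ((Algebra.norm ℚ (x : K) : ℚ) : ℝ) / c ^ n := by
  have hcn : 0 < c ^ n := pow_pos hc n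
  let S : Set ℕ := {N | ∃ x : Fin n → I, x ≠ 0 ∧
    (N : ℝ) = ‖algebraMap K ℂ (leftMulMatrix σ γ fun l => ((x l : 𝓞 K) : K)).det‖ ^ 2}
  have hval (x : Fin n → I) := exists_nat_dvd_sq_norm_det (φ := algebraMap K ℂ) hF hn hσ hgen hγ hγ0 x
  have hne (x : Fin n → I) (hx : x ≠ 0) : (fun l => ((x l : 𝓞 K) : K)) ≠ 0 := by
    contrapose! hx
    ext l : 2
    exact RingOfIntegers.coe_injective (congrFun hx l)
  have hS : S.Nonempty := by
    obtain ⟨y, hy, hy0⟩ := Submodule.exists_mem_ne_zero_of_ne_bot hI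
    obtain ⟨N, hN, -⟩ := hval fun _ => ⟨y, hy⟩
    refine ⟨N, _, fun h => hy0 ?_, hN⟩
    simpa using congrFun h 0
  obtain ⟨x₀, hx₀, hN₀⟩ := Nat.sInf_mem hS
  refine ⟨(sInf S : ℕ) / c ^ n, ⟨⟨_, ⟨x₀, rfl⟩, ?_, ?_⟩, ?_⟩, ?_, ?_⟩
  · intro h
    have h1 := sq_norm_det_codeword hc (leftMulMatrix σ γ fun l => ((x₀ l : 𝓞 K) : K))
    rw [h, Matrix.det_zero, norm_zero] at h1
    have h2 : ‖algebraMap K ℂ (leftMulMatrix σ γ fun l => ((x₀ l : 𝓞 K) : K)).det‖ ^ 2 = 0 := by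
      field_simp at h1
      simpa using h1.symm
    exact hdiv _ (hne x₀ hx₀) (by simpa using h2)
  · rw [sq_norm_det_codeword hc, hN₀]
  · rintro _ ⟨_, ⟨x, rfl⟩, hx, rfl⟩
    rw [sq_norm_det_codeword hc]
    obtain ⟨N, hN, -⟩ := hval x
    have hx0 : x ≠ 0 := by
      rintro rfl
      apply hx
      ext i j
      simp [leftMulMatrix]
    rw [← hN]
    gcongr
    exact Nat.sInf_le ⟨x, hx0, hN⟩
  · obtain ⟨N, hN, hdvd⟩ := hval x₀
    have : N = sInf S := by exact_mod_cast hN.trans hN₀.symm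
    rw [this] at hdvd
    gcongr
    refine Nat.le_of_dvd (Nat.pos_of_ne_zero fun h => ?_) hdvd
    rw [h] at hN₀
    exact hdiv _ (hne x₀ hx₀) (by simpa using hN₀.symm)
  · intro y hy hy0
    obtain ⟨N, hN, -⟩ := hval (Pi.single 0 ⟨y, hy⟩)
    have h1 : (fun l => (((Pi.single 0 ⟨y, hy⟩ : Fin n → I) l : 𝓞 K) : K)) =
        Pi.single 0 (y : K) := by
      ext l
      by_cases hl : l = 0
      · subst hl; simp
      · simp [hl]
    have h2 : (N : ℝ) = ((Algebra.norm ℚ (y : K) : ℚ) : ℝ) := by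
      rw [hN, h1, leftMulMatrix_single_zero, Matrix.det_diagonal,
        prod_pow_apply_eq_norm hn hσ hgen, norm_eq_sq_norm_norm (φ := algebraMap K ℂ) hF]
    rw [← h2]
    gcongr
    refine Nat.sInf_le ⟨_, fun h => hy0 ?_, hN⟩
    simpa using congrFun h 0

end Code

/-! ### Relative integral bases and the volume of the lattice -/

section Volume

variable {F L K : Type*} [Field F] [NumberField F] [Field L] [NumberField L] [Field K]
  [NumberField K] [Algebra F K] [Algebra L K]

/-- In a compositum of number fields with coprime discriminants, one of which is Galois over `ℚ`,
an integral basis of the one is a relative integral basis over the other. -/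
theorem exists_basis_of_isCoprime_discr [IsGalois ℚ L]
    (htop : (IsScalarTower.toAlgHom ℚ F K).fieldRange ⊔
      (IsScalarTower.toAlgHom ℚ L K).fieldRange = ⊤)
    (hcop : IsCoprime (discr F) (discr L)) {ι : Type*} (b : Module.Basis ι ℤ (𝓞 L)) :
    ∃ w : Module.Basis ι (𝓞 F) (𝓞 K), ∀ i, w i = algebraMap (𝓞 L) (𝓞 K) (b i) := by
  -- Linear disjointness concerns subfields of `K`, so `F` and `L` are replaced by their images,
  -- which inherit the structure of fraction fields of `𝓞 F` and `𝓞 L`.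
  let F₁ := (IsScalarTower.toAlgHom ℚ F K).fieldRange
  let F₂ := (IsScalarTower.toAlgHom ℚ L K).fieldRange
  let e₁ : F ≃ₐ[ℚ] F₁ := AlgEquiv.ofInjectiveField (IsScalarTower.toAlgHom ℚ F K)
  let e₂ : L ≃ₐ[ℚ] F₂ := AlgEquiv.ofInjectiveField (IsScalarTower.toAlgHom ℚ L K)
  have : IsGalois ℚ F₂ := IsGalois.of_algEquiv e₂
  have hdisj : F₁.LinearDisjoint F₂ := by
    refine (linearDisjoint_of_isGalois_isCoprime_discr K F₂ F₁ ?_).symm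
    rw [← discr_eq_discr_of_algEquiv F e₁, ← discr_eq_discr_of_algEquiv L e₂]
    exact hcop.symm
  let : Algebra (𝓞 F) F₁ := ((e₁ : F →+* F₁).comp (algebraMap (𝓞 F) F)).toAlgebra
  let : Algebra (𝓞 L) F₂ := ((e₂ : L →+* F₂).comp (algebraMap (𝓞 L) L)).toAlgebra
  let e₁' : F ≃ₐ[𝓞 F] F₁ := { e₁ with commutes' := fun _ => rfl }
  let e₂' : L ≃ₐ[𝓞 L] F₂ := { e₂ with commutes' := fun _ => rfl }
  have : IsFractionRing (𝓞 F) F₁ := IsLocalization.isLocalization_of_algEquiv _ e₁'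
  have : IsFractionRing (𝓞 L) F₂ := IsLocalization.isLocalization_of_algEquiv _ e₂'
  have : IsScalarTower (𝓞 F) F₁ K := IsScalarTower.of_algebraMap_eq fun _ => rfl
  have : IsScalarTower (𝓞 L) F₂ K := IsScalarTower.of_algebraMap_eq fun _ => rfl
  have h₂ : F₁.toSubalgebra ⊔ F₂.toSubalgebra = ⊤ := by
    rw [← sup_toSubalgebra_of_left, htop, top_toSubalgebra]
  have h₃ := isCoprime_differentIdeal_of_isCoprime_discr K hcop
  refine ⟨b.ofIsCoprimeDifferentIdeal ℤ (𝓞 K) (𝓞 F) (𝓞 L) hdisj h₂ h₃, fun i => ?_⟩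
  exact Module.Basis.ofIsCoprimeDifferentIdeal_apply ℤ (𝓞 K) (𝓞 F) (𝓞 L) hdisj h₂ h₃ b i

/-- `D` is the determinant of the `𝓞 F`-endomorphism of `𝓞 K` that carries `w` to `ν`. Its norm is
the determinant of the same map over `ℤ`, which up to sign is the index of the image `I`. -/
theorem exists_det_eq_det_mul {ι : Type*} [Fintype ι] [DecidableEq ι] {I : Ideal (𝓞 K)}
    (ν : Module.Basis ι (𝓞 F) I) (w : Module.Basis ι (𝓞 F) (𝓞 K)) (σ : ι → K ≃ₐ[F] K) :
    ∃ D : 𝓞 F, (Algebra.norm ℤ D).natAbs = Ideal.absNorm I ∧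
      (Matrix.of fun m k => σ m ((ν k : 𝓞 K) : K)).det =
        (Matrix.of fun m k => σ m (w k : K)).det * algebraMap F K D := by
  have : Module.Free (𝓞 F) (𝓞 K) := Module.Free.of_basis w
  let e : 𝓞 K ≃ₗ[𝓞 F] I := w.equiv ν (Equiv.refl ι)
  let f : 𝓞 K →ₗ[𝓞 F] 𝓞 K := (I.subtype.restrictScalars (𝓞 F)) ∘ₗ e.toLinearMap
  have hf (k : ι) : f (w k) = ν k := by simp [f, e]
  refine ⟨LinearMap.det f, ?_, ?_⟩
  · rw [← LinearMap.det_restrictScalars, ← Ideal.natAbs_det_equiv I e]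
    rfl
  · rw [← LinearMap.det_toMatrix w]
    have : (Matrix.of fun m k => σ m ((ν k : 𝓞 K) : K)) =
        (Matrix.of fun m k => σ m (w k : K)) *
          (LinearMap.toMatrix w w f).map ((algebraMap F K).comp (algebraMap (𝓞 F) F)) := by
      ext m k
      have h := w.sum_repr (f (w k))
      rw [Matrix.mul_apply, Matrix.of_apply, ← hf, ← h]
      simp only [map_sum, Matrix.of_apply, Matrix.map_apply, LinearMap.toMatrix_apply]
      refine Finset.sum_congr rfl fun l _ => ?_
      rw [Algebra.smul_def, map_mul, map_mul, mul_comm]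
      congr 1
      exact (σ m).commutes _
    rw [this, Matrix.det_mul]
    congr 1
    exact (RingHom.map_det ((algebraMap F K).comp (algebraMap (𝓞 F) F)) _).symm

theorem discr_pos_of_isTotallyReal [IsTotallyReal L] : 0 < discr L := by
  rw [← Int.sign_eq_one_iff_pos, sign_discr, IsTotallyReal.nrComplexPlaces_eq_zero, pow_zero]

/-- The powers of `σ` restrict to all the complex embeddings of `L`, so the squared determinant is
the discriminant, positive by total reality. -/
theorem sq_norm_det_conjugates_eq_discr [IsTotallyReal L] {n : ℕ} [NeZero n] {σ : K ≃ₐ[F] K}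
    (φ : K →ₐ[ℚ] ℂ) (hn : Module.finrank ℚ L = n)
    (hinj : Function.Injective fun j : Fin n =>
      (φ.comp ((σ ^ (j : ℕ)).toAlgHom.restrictScalars ℚ)).comp (IsScalarTower.toAlgHom ℚ L K))
    (b : Module.Basis (Fin n) ℤ (𝓞 L)) :
    ‖φ (Matrix.of fun (m k : Fin n) => (σ ^ (m : ℕ)) (algebraMap L K (b k))).det‖ ^ 2 =
      (discr L : ℝ) := by
  let e : Fin n ≃ (L →ₐ[ℚ] ℂ) := Equiv.ofBijective _ <| by
    rw [Fintype.bijective_iff_injective_and_card]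
    exact ⟨hinj, by rw [Fintype.card_fin, AlgHom.card, hn]⟩
  have h1 := Algebra.discr_eq_det_embeddingsMatrixReindex_pow_two ℚ ℂ
    (b.localizationLocalization ℚ (nonZeroDivisors ℤ) L) e
  rw [Algebra.discr_localizationLocalization, discr_eq_discr] at h1
  have h2 : (Algebra.embeddingsMatrixReindex ℚ ℂ
      (b.localizationLocalization ℚ (nonZeroDivisors ℤ) L) e).det =
      φ (Matrix.of fun (m k : Fin n) => (σ ^ (m : ℕ)) (algebraMap L K (b k))).det := by
    rw [AlgHom.map_det, ← Matrix.det_transpose]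
    congr 1
    ext m k
    simp [Algebra.embeddingsMatrixReindex, e]
  rw [h2] at h1
  have h3 := congrArg norm h1
  rw [norm_pow] at h3
  rw [← h3]
  have : (0 : ℝ) < discr L := by exact_mod_cast discr_pos_of_isTotallyReal
  simp [abs_of_pos this]

end Volume

/-! ### The two base fields and unitary determinants -/

theorem zetaThree_isPrimitiveRoot : IsPrimitiveRoot zetaThree 3 :=
  Complex.isPrimitiveRoot_exp 3 (by norm_num)

theorem zetaThree_sq : zetaThree ^ 2 + zetaThree + 1 = 0 := by
  have h1 : zetaThree ^ 3 = 1 := zetaThree_isPrimitiveRoot.pow_eq_one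
  have h2 : zetaThree - 1 ≠ 0 :=
    sub_ne_zero.mpr (zetaThree_isPrimitiveRoot.ne_one (by norm_num))
  apply mul_left_cancel₀ h2
  linear_combination h1

theorem zetaThree_im_ne_zero : zetaThree.im ≠ 0 := by
  intro h
  have h1 := congrArg Complex.re zetaThree_sq
  simp [sq, h] at h1
  nlinarith [sq_nonneg (zetaThree.re + 1 / 2)]

theorem norm_baseSix (y : baseSix) : ((Algebra.norm ℚ y : ℚ) : ℝ) = ‖(y : ℂ)‖ ^ 2 :=
  norm_adjoin_eq_sq_norm (a := 1) (b := 1) zetaThree_im_ne_zero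
    (by simpa using zetaThree_sq) y

theorem norm_base_eq {F : IntermediateField ℚ ℂ} (hF : F = ℚ⟮Complex.I⟯ ∨ F = ℚ⟮zetaThree⟯)
    (y : F) : ((Algebra.norm ℚ y : ℚ) : ℝ) = ‖(y : ℂ)‖ ^ 2 := by
  rcases hF with rfl | rfl
  · exact norm_adjoin_eq_sq_norm (z := Complex.I) (a := 0) (b := 1) (by simp) (by simp) y
  · exact norm_baseSix y

theorem sq_norm_det_of_unitary {n : ℕ} {c : ℝ} (hc : 0 < c) {R : Matrix (Fin n) (Fin n) ℂ}
    (h : (((√c)⁻¹ : ℝ) : ℂ) • R ∈ Matrix.unitaryGroup (Fin n) ℂ) : ‖R.det‖ ^ 2 = c ^ n := by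
  have h1 : ‖((((√c)⁻¹ : ℝ) : ℂ) • R).det‖ = 1 :=
    CStarRing.norm_of_mem_unitary (Matrix.det_of_mem_unitary h)
  have h2 := congrArg (· ^ 2) h1
  simp only [Matrix.det_smul, norm_mul, norm_pow, mul_pow, Fintype.card_fin, Complex.norm_real] at h2
  rw [← pow_mul, mul_comm n 2, pow_mul, Real.norm_eq_abs, sq_abs, inv_pow, Real.sq_sqrt hc.le,
    inv_pow, one_pow] at h2
  field_simp at h2
  exact h2

/-! ### The bounds for a general perfect code -/

section General

variable {F : IntermediateField ℚ ℂ} {K : IntermediateField F ℂ} {n : ℕ} [NeZero n]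

theorem det_ne_zero_of_division {σ : K ≃ₐ[F] K} {γ : F} {hσ : σ ^ n = 1}
    (hdiv : ∀ a : cyclicAlgebra σ γ hσ, a ≠ 0 → IsUnit a) (x : Fin n → K) (hx : x ≠ 0) :
    (leftMulMatrix σ γ x).det ≠ 0 := by
  have h := hdiv ⟨leftMulMatrix σ γ x, x, rfl⟩ fun h =>
    leftMulMatrix_apply_ne_zero hx (congrArg Subtype.val h)
  have h2 := h.map (cyclicAlgebra σ γ hσ).val
  exact ((Matrix.isUnit_iff_isUnit_det _).mp h2).ne_zero

theorem adjoin_simple_eq_top_of_eq_adjoin {k E : Type*} [Field k] [Field E] [Algebra k E]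
    {S : IntermediateField k E} {x : E} (hS : S = k⟮x⟯) :
    k⟮(⟨x, hS ▸ mem_adjoin_simple_self k x⟩ : S)⟯ = ⊤ := by
  apply lift_injective
  rw [lift_adjoin_simple, lift_top]
  exact hS.symm

theorem algEquiv_ext_of_eq_adjoin {k E : Type*} [Field k] [Field E] [Algebra k E]
    {S : IntermediateField k E} {x : E} (hS : S = k⟮x⟯) {f g : S ≃ₐ[k] S}
    (h : (f ⟨x, hS ▸ mem_adjoin_simple_self k x⟩ : E) =
      g ⟨x, hS ▸ mem_adjoin_simple_self k x⟩) : f = g := by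
  have h' : (f : S →ₐ[k] S) = g := by
    refine algHom_ext_of_eq_adjoin k hS fun y hy => ?_
    obtain rfl : y = x := hy
    exact Subtype.ext h
  exact AlgEquiv.ext fun y => DFunLike.congr_fun h' y

theorem absNorm_mul_discr_eq_vol [NumberField F] {θ : ℂ} [NumberField ℚ⟮θ⟯] [NumberField K]
    [IsTotallyReal ℚ⟮θ⟯] [IsGalois ℚ ℚ⟮θ⟯] [IsGalois F K]
    (hF : ∀ y : F, ((Algebra.norm ℚ y : ℚ) : ℝ) = ‖(y : ℂ)‖ ^ 2)
    (hn : Module.finrank ℚ ℚ⟮θ⟯ = n) (hcop : IsCoprime (discr F) (discr ℚ⟮θ⟯)) (hK : K = F⟮θ⟯)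
    {σ : K ≃ₐ[F] K} (hσ : σ ^ n = 1) (hgen : ∀ τ : K ≃ₐ[F] K, τ ∈ Subgroup.zpowers σ)
    {I : Ideal (𝓞 K)} (ν : Module.Basis (Fin n) (𝓞 F) I) :
    Module.finrank F K = n ∧
      complexLatticeVol σ ν = (Ideal.absNorm I : ℝ) * (discr ℚ⟮θ⟯ : ℝ) := by
  have hle : ℚ⟮θ⟯ ≤ K.restrictScalars ℚ := by
    rw [adjoin_simple_le_iff, hK]
    exact mem_adjoin_simple_self F θ
  let : Algebra ℚ⟮θ⟯ K := RingHom.toAlgebra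
    { toFun := fun y => ⟨y, hle y.2⟩
      map_one' := rfl
      map_mul' := fun _ _ => rfl
      map_zero' := rfl
      map_add' := fun _ _ => rfl }
  have hLK (y : ℚ⟮θ⟯) : ((algebraMap ℚ⟮θ⟯ K y : K) : ℂ) = y := rfl
  have htop : (IsScalarTower.toAlgHom ℚ F K).fieldRange ⊔
      (IsScalarTower.toAlgHom ℚ ℚ⟮θ⟯ K).fieldRange = ⊤ := by
    set E := (IsScalarTower.toAlgHom ℚ F K).fieldRange ⊔
      (IsScalarTower.toAlgHom ℚ ℚ⟮θ⟯ K).fieldRange with hE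
    -- The compositum, regarded over `F`, contains `θ` and so is all of `K`.
    let E' : IntermediateField F K :=
      { E.toSubfield with
        algebraMap_mem' := fun y =>
          (le_sup_left : _ ≤ E) (AlgHom.mem_fieldRange.mpr ⟨y, rfl⟩) }
    have hθ : (⟨θ, hle (mem_adjoin_simple_self ℚ θ)⟩ : K) ∈ E' :=
      (le_sup_right : _ ≤ E) (AlgHom.mem_fieldRange.mpr ⟨AdjoinSimple.gen ℚ θ, rfl⟩)
    have htop : (⊤ : IntermediateField F K) ≤ E' := by
      rw [← adjoin_simple_eq_top_of_eq_adjoin hK, adjoin_simple_le_iff]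
      exact hθ
    exact eq_top_iff.mpr fun x _ => htop (mem_top (x := x))
  let b : Module.Basis (Fin n) ℤ (𝓞 ℚ⟮θ⟯) :=
    (RingOfIntegers.basis ℚ⟮θ⟯).reindex (Fintype.equivFinOfCardEq <| by
      rw [← Module.finrank_eq_card_basis (RingOfIntegers.basis ℚ⟮θ⟯), RingOfIntegers.rank, hn])
  obtain ⟨w, hw⟩ := exists_basis_of_isCoprime_discr htop hcop b
  -- The degree of `K/F` is read off from the relative integral basis.
  have hrank : Module.finrank F K = n := by
    rw [IsFractionRing.finrank_eq (𝓞 F) F (𝓞 K) K, Module.finrank_eq_card_basis w,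
      Fintype.card_fin]
  refine ⟨hrank, ?_⟩
  obtain ⟨D, hD, hdet⟩ := exists_det_eq_det_mul ν w fun m : Fin n => σ ^ (m : ℕ)
  let φ : K →ₐ[ℚ] ℂ := (algebraMap K ℂ).toRatAlgHom
  have hinj : Function.Injective fun j : Fin n =>
      (φ.comp ((σ ^ (j : ℕ)).toAlgHom.restrictScalars ℚ)).comp
        (IsScalarTower.toAlgHom ℚ ℚ⟮θ⟯ K) := by
    intro i j hij
    refine (bijective_pow_of_generator hrank hσ hgen).1 ?_
    -- An `F`-automorphism of `K` is determined by its value at `θ`, hence by its restriction to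
    -- `ℚ(θ)`.
    exact algEquiv_ext_of_eq_adjoin hK (DFunLike.congr_fun hij (AdjoinSimple.gen ℚ θ))
  have hd := sq_norm_det_conjugates_eq_discr φ hn hinj b
  have h1 : (generatorMatrix σ ν).det =
      φ (Matrix.of fun m k : Fin n => (σ ^ (m : ℕ)) ((ν k : 𝓞 K) : K)).det := by
    rw [AlgHom.map_det]
    rfl
  rw [complexLatticeVol, h1, hdet, map_mul, norm_mul, mul_pow, ← hD,
    natAbs_norm_eq_sq_norm (φ := algebraMap K ℂ) hF, ← hd, mul_comm]
  have h2 : (Matrix.of fun m k : Fin n => (σ ^ (m : ℕ)) (w k : K)) =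
      Matrix.of fun m k : Fin n => (σ ^ (m : ℕ)) (algebraMap ℚ⟮θ⟯ K (b k)) := by
    ext m k
    rw [Matrix.of_apply, Matrix.of_apply, hw]
    rfl
  rw [h2]
  rfl

theorem perfectCode_bounds [NumberField F] {θ : ℂ} [NumberField ℚ⟮θ⟯] [NumberField K]
    {σ : K ≃ₐ[F] K} {γ : F} {I : Ideal (𝓞 K)} {ν : Module.Basis (Fin n) (𝓞 F) I} {c : ℝ}
    (h : IsPerfectCode θ σ γ ν c) :
    ∃ δ m : ℝ, IsMinDet (infiniteCode n σ γ I c) δ ∧ IsMinNorm I m ∧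
      (Ideal.absNorm I : ℝ) / complexLatticeVol σ ν = 1 / (discr ℚ⟮θ⟯ : ℝ) ∧
      1 / (discr ℚ⟮θ⟯ : ℝ) ≤ δ ∧ δ ≤ 1 / complexLatticeVol σ ν * m := by
  have hF := norm_base_eq h.base
  have := h.totallyReal
  have := h.galois
  have := h.cyclic.1
  obtain ⟨hn, hvol⟩ := absNorm_mul_discr_eq_vol hF h.degree h.coprime h.compositum h.pow_eq_one
    h.cyclic.2 ν
  have hvol' : complexLatticeVol σ ν = c ^ n := sq_norm_det_of_unitary h.pos h.shaping
  have hI : I ≠ ⊥ := by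
    rintro rfl
    exact ν.ne_zero 0 (Subsingleton.elim _ _)
  have hγ0 : γ ≠ 0 := by
    rintro rfl
    simpa using h.energy
  have hd : (0 : ℝ) < discr ℚ⟮θ⟯ := by exact_mod_cast discr_pos_of_isTotallyReal
  have hN : (Ideal.absNorm I : ℝ) ≠ 0 := by
    simpa [Ideal.absNorm_eq_zero_iff] using hI
  have heq : (Ideal.absNorm I : ℝ) / complexLatticeVol σ ν = 1 / (discr ℚ⟮θ⟯ : ℝ) := by
    rw [hvol]
    field_simp
  obtain ⟨δ, hδ, hlow, hup⟩ := exists_isMinDet hF hn h.pow_eq_one h.cyclic.2 h.integral hγ0 hI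
    h.pos (det_ne_zero_of_division h.division)
  obtain ⟨m, hm⟩ := exists_isLeast_norm (φ := algebraMap K ℂ) hF hI
  refine ⟨δ, m, hδ, hm, heq, ?_, ?_⟩
  · rwa [← heq, hvol']
  · obtain ⟨x, hx, hx0, rfl⟩ := hm.1
    rw [hvol', one_div, ← div_eq_inv_mul]
    exact hup x hx hx0

end General

/-! ### Division algebras by reduction modulo a prime -/

/-- A finite family of elements of the fraction field of a Dedekind domain, not all zero, can be
scaled so that it is integral, but not contained in a given proper ideal. -/
theorem exists_mul_eq_algebraMap_notMem {R K ι : Type*} [CommRing R] [IsDedekindDomain R] [Field K]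
    [Algebra R K] [IsFractionRing R K] [Finite ι] {P : Ideal R} (hP : P ≠ ⊤) {x : ι → K}
    (hx : x ≠ 0) :
    ∃ (l : K) (a : ι → R), (∀ i, algebraMap R K (a i) = l * x i) ∧ ∃ i, a i ∉ P := by
  obtain ⟨b, hb⟩ := IsLocalization.exist_integer_multiples_of_finite (nonZeroDivisors R) x
  choose y hy using hb
  have hb0 : algebraMap R K b ≠ 0 := IsFractionRing.to_map_ne_zero_of_mem_nonZeroDivisors b.2
  simp only [Algebra.smul_def] at hy
  let J : Ideal R := Ideal.span (Set.range y)
  have hJ : J ≠ ⊥ := by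
    intro h
    apply hx
    ext i
    have : y i = 0 := by
      have : y i ∈ J := Ideal.subset_span ⟨i, rfl⟩
      simpa [h] using this
    have h2 := hy i
    rw [this, map_zero] at h2
    exact (mul_eq_zero.mp h2.symm).resolve_left hb0
  have hJ' : (J : FractionalIdeal (nonZeroDivisors R) K) ≠ 0 :=
    FractionalIdeal.coeIdeal_ne_zero.mpr hJ
  have hint (l : K) (hl : l ∈ (J : FractionalIdeal (nonZeroDivisors R) K)⁻¹) (i : ι) :
      ∃ a : R, algebraMap R K a = l * algebraMap R K (y i) := by
    have := (FractionalIdeal.mem_inv_iff hJ').mp hl (algebraMap R K (y i))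
      (FractionalIdeal.mem_coeIdeal_of_mem _ (Ideal.subset_span ⟨i, rfl⟩))
    exact (FractionalIdeal.mem_one_iff _).mp this
  by_contra! hcon
  -- If every integral scaling of the family lay in `P`, then `1 = J⁻¹ J` would be contained in `P`.
  have hle : (1 : FractionalIdeal (nonZeroDivisors R) K) ≤ P := by
    rw [← inv_mul_cancel₀ hJ', FractionalIdeal.mul_le]
    rintro l hl z hzJ
    obtain ⟨r, hr, rfl⟩ := (FractionalIdeal.mem_coeIdeal _).mp hzJ
    clear hzJ
    induction hr using Submodule.span_induction with
    | mem z hz =>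
      obtain ⟨i, rfl⟩ := hz
      choose a ha using hint l hl
      rw [← ha]
      refine FractionalIdeal.mem_coeIdeal_of_mem _ (hcon (l * algebraMap R K b) a (fun i => ?_) i)
      rw [ha, hy, mul_assoc]
    | zero => simp
    | add u v _ _ hu hv =>
      rw [map_add, mul_add]
      exact Submodule.add_mem (P : FractionalIdeal (nonZeroDivisors R) K).coeToSubmodule hu hv
    | smul r u _ hu =>
      rw [smul_eq_mul, map_mul, mul_left_comm, ← Algebra.smul_def]
      exact Submodule.smul_mem (P : FractionalIdeal (nonZeroDivisors R) K).coeToSubmodule _ hu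
  have h1 := hle (FractionalIdeal.one_mem_one _)
  obtain ⟨u, hu, hu1⟩ := (FractionalIdeal.mem_coeIdeal _).mp h1
  have : u = 1 := IsFractionRing.injective R K (by rw [hu1, map_one])
  exact hP ((Ideal.eq_top_iff_one P).mpr (this ▸ hu))

/-- Column `j` holds coefficients of `α^j a(α)`, where `a(α) = ∑ aᵢ αⁱ`. A kernel vector `v` would
give `v(α) a(α) = 0` in a field, although both factors are nonzero by independence. -/
theorem det_leftMulMatrix_one_ne_zero {k L : Type*} [Field k] [Field L] [Algebra k L] {n : ℕ}
    [NeZero n] {α : L} {g : k} (hα : α ^ n = algebraMap k L g)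
    (hli : LinearIndependent k fun i : Fin n => α ^ (i : ℕ)) {a : Fin n → k} (ha : a ≠ 0) :
    (leftMulMatrix (1 : k ≃ₐ[k] k) g a).det ≠ 0 := by
  rw [Fintype.linearIndependent_iff] at hli
  have hcol (j : Fin n) : ∑ i, leftMulMatrix (1 : k ≃ₐ[k] k) g a i j • α ^ (i : ℕ) =
      α ^ (j : ℕ) * ∑ i, a i • α ^ (i : ℕ) := by
    rw [Finset.mul_sum]
    refine (Fintype.sum_equiv (Equiv.addRight j) _ _ fun m => ?_).symm
    rw [show (Equiv.addRight j) m = m + j from rfl]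
    simp only [leftMulMatrix, Matrix.of_apply, add_sub_cancel_right, one_pow, AlgEquiv.one_apply,
      Algebra.algebraMap_self, RingHom.id_apply, Fin.le_def, Fin.val_add, Algebra.smul_def, map_mul]
    split_ifs with h
    · have hlt : (m : ℕ) + j < n := by
        by_contra hge
        rw [Nat.mod_eq_sub_mod (by omega), Nat.mod_eq_of_lt (by omega)] at h
        omega
      rw [Nat.mod_eq_of_lt hlt, pow_add, map_one]
      ring
    · have hge : n ≤ (m : ℕ) + j := by
        by_contra hlt
        rw [Nat.mod_eq_of_lt (by omega)] at h
        omega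
      have hpow : α ^ (((m : ℕ) + j) % n) * algebraMap k L g = α ^ (m : ℕ) * α ^ (j : ℕ) := by
        rw [Nat.mod_eq_sub_mod hge, Nat.mod_eq_of_lt (by omega), ← hα, ← pow_add, ← pow_add]
        congr 1
        omega
      linear_combination (-algebraMap k L (a m)) * hpow
  intro hdet
  obtain ⟨v, hv, hMv⟩ := Matrix.exists_mulVec_eq_zero_iff.mpr hdet
  have hprod : (∑ j, v j • α ^ (j : ℕ)) * ∑ i, a i • α ^ (i : ℕ) = 0 := by
    rw [Finset.sum_mul]
    simp_rw [smul_mul_assoc, ← hcol, Finset.smul_sum]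
    rw [Finset.sum_comm]
    refine Finset.sum_eq_zero fun i _ => ?_
    simp_rw [smul_smul, ← Finset.sum_smul]
    have := congrFun hMv i
    rw [Matrix.mulVec, dotProduct] at this
    simp_rw [mul_comm (v _), this]
    simp
  rcases mul_eq_zero.mp hprod with h | h
  · exact hv (funext (hli v h))
  · exact ha (funext (hli a h))

/-- If `σ` acts trivially on a residue field `k` and `1, α, …, α ^ (n - 1)` are independent over
`k`, where `α ^ n` is the residue of `γ`, then the cyclic algebra is a division algebra. -/
theorem det_leftMulMatrix_ne_zero_of_residue {F K k L : Type*} [Field F] [Field K] [NumberField K]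
    [Algebra F K] [Field k] [Field L] [Algebra k L] {n : ℕ} [NeZero n] {σ : K ≃ₐ[F] K}
    {π : 𝓞 K →+* k} (hπ : ∀ x, π (RingOfIntegers.mapRingEquiv σ.toRingEquiv x) = π x) {g : 𝓞 F}
    {α : L} (hα : α ^ n = algebraMap k L (π (algebraMap (𝓞 F) (𝓞 K) g)))
    (hli : LinearIndependent k fun i : Fin n => α ^ (i : ℕ)) (x : Fin n → K) (hx : x ≠ 0) :
    (leftMulMatrix σ (g : F) x).det ≠ 0 := by
  obtain ⟨l, a, ha, i, hi⟩ := exists_mul_eq_algebraMap_notMem (R := 𝓞 K)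
    (RingHom.ker_ne_top π) hx
  have hpow (j : ℕ) (y : 𝓞 K) :
      π (RingOfIntegers.mapRingEquiv (σ ^ j).toRingEquiv y) = π y := by
    induction j generalizing y with
    | zero => rfl
    | succ j ih =>
      rw [show RingOfIntegers.mapRingEquiv (σ ^ (j + 1)).toRingEquiv y =
        RingOfIntegers.mapRingEquiv (σ ^ j).toRingEquiv
          (RingOfIntegers.mapRingEquiv σ.toRingEquiv y) from rfl, ih, hπ]
  have hred : (integralLeftMulMatrix σ g a).map π =
      leftMulMatrix (1 : k ≃ₐ[k] k) (π (algebraMap (𝓞 F) (𝓞 K) g)) fun i => π (a i) := by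
    ext i j
    simp [integralLeftMulMatrix, leftMulMatrix, hpow, apply_ite π]
  have h1 : π (integralLeftMulMatrix σ g a).det ≠ 0 := by
    rw [RingHom.map_det, RingHom.mapMatrix_apply, hred]
    exact det_leftMulMatrix_one_ne_zero hα hli fun h => hi (congrFun h i)
  intro hdet
  apply h1
  have h2 := coe_det_integralLeftMulMatrix σ g a
  rw [show (fun i => (a i : K)) = fun i => l * x i from funext ha, leftMulMatrix_smul,
    Matrix.det_mul, hdet, zero_mul] at h2
  rw [RingOfIntegers.coe_injective (h2.trans (map_zero (algebraMap (𝓞 K) K)).symm), map_zero]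

/-- The hypothesis says `Φ₆(g) = 0`, so `g` has order `6` and a sixth root `α` has order `36`. If
`α` has degree `d` then `36 ∣ 7^d - 1`, and `7` has order `6` modulo `36`, so `d ≥ 6`. -/
theorem exists_pow_six_eq_linearIndependent {k : Type*} [Field k] (hk : Nat.card k = 7) {g : k}
    (hg : g ^ 2 - g + 1 = 0) :
    ∃ α : AlgebraicClosure k, α ^ 6 = algebraMap k _ g ∧
      LinearIndependent k fun i : Fin 6 => α ^ (i : ℕ) := by
  have : Finite k := Nat.finite_of_card_ne_zero (by omega)
  have : Fintype k := Fintype.ofFinite k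
  have h7 : (7 : k) = 0 := by
    have := FiniteField.cast_card_eq_zero k
    rw [← Nat.card_eq_fintype_card, hk] at this
    exact_mod_cast this
  have h3 : (3 : k) ≠ 0 := by
    intro h
    exact one_ne_zero (α := k) (by linear_combination h7 - 2 * h)
  have hg2 : g ^ 2 ≠ 1 := by
    intro h
    apply h3
    have : g = 2 := by linear_combination h - hg
    rw [this] at h
    linear_combination h
  have hg3 : g ^ 3 = -1 := by linear_combination (g + 1) * hg
  have hg3' : g ^ 3 ≠ 1 := by
    intro h
    have h2 : (2 : k) = 0 := by linear_combination hg3 - h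
    exact one_ne_zero (α := k) (by linear_combination h7 - 3 * h2)
  obtain ⟨α, hα⟩ := IsAlgClosed.exists_pow_nat_eq (algebraMap k (AlgebraicClosure k) g)
    (n := 6) (by norm_num)
  refine ⟨α, hα, ?_⟩
  have hord : orderOf α = 36 := by
    refine orderOf_eq_of_pow_and_pow_div_prime (by norm_num) ?_ fun p hp hp36 => ?_
    · rw [show 36 = 6 * 6 by norm_num, pow_mul, hα, ← map_pow,
        show g ^ 6 = (g ^ 3) ^ 2 by ring, hg3]
      simp
    · have : p = 2 ∨ p = 3 := by
        rw [show 36 = 2 ^ 2 * 3 ^ 2 by norm_num] at hp36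
        rcases (Nat.Prime.dvd_mul hp).mp hp36 with h | h
        · exact Or.inl ((Nat.prime_dvd_prime_iff_eq hp Nat.prime_two).mp (hp.dvd_of_dvd_pow h))
        · exact Or.inr ((Nat.prime_dvd_prime_iff_eq hp Nat.prime_three).mp (hp.dvd_of_dvd_pow h))
      rcases this with rfl | rfl
      · rw [show 36 / 2 = 6 * 3 by norm_num, pow_mul, hα, ← map_pow]
        exact fun h => hg3' ((algebraMap k (AlgebraicClosure k)).injective (by rw [h, map_one]))
      · rw [show 36 / 3 = 6 * 2 by norm_num, pow_mul, hα, ← map_pow]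
        exact fun h => hg2 ((algebraMap k (AlgebraicClosure k)).injective (by rw [h, map_one]))
  have hint : IsIntegral k α := Algebra.IsIntegral.isIntegral α
  have : FiniteDimensional k k⟮α⟯ := adjoin.finiteDimensional hint
  have : Finite k⟮α⟯ := Module.finite_of_finite k
  have hcard : Nat.card k⟮α⟯ = 7 ^ (minpoly k α).natDegree := by
    rw [← adjoin.finrank hint, Module.natCard_eq_pow_finrank (K := k), hk]
  have hdvd : 36 ∣ 7 ^ (minpoly k α).natDegree - 1 := by
    rw [← hord, orderOf_dvd_iff_pow_eq_one, ← hcard]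
    have hα0 : AdjoinSimple.gen k α ≠ 0 := by
      intro h
      have : α = 0 := by simpa using congrArg (algebraMap k⟮α⟯ (AlgebraicClosure k)) h
      rw [this] at hord
      simp at hord
    have : Fintype k⟮α⟯ := Fintype.ofFinite _
    have h := FiniteField.pow_card_sub_one_eq_one _ hα0
    rw [← Nat.card_eq_fintype_card] at h
    simpa using congrArg (algebraMap k⟮α⟯ (AlgebraicClosure k)) h
  have hpos : 0 < (minpoly k α).natDegree := minpoly.natDegree_pos hint
  have hge : 6 ≤ (minpoly k α).natDegree := by
    by_contra! hlt
    generalize (minpoly k α).natDegree = d at *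
    interval_cases d <;> omega
  exact (linearIndependent_pow (K := k) α).comp (Fin.castLE hge) (Fin.castLE_injective hge)

/-! ### Total ramification above seven -/

section PrimeAboveSeven

variable {K : Type*} [Field K] {t a a' : 𝓞 K}

/-- Taking norms in `t^6 = 7 (t^2 - 1)^2`, where `t^2 - 1` is a unit, gives `|N(t)|^6 = 7^12`. -/
theorem natAbs_norm_eq (ht : t ^ 6 - 7 * t ^ 4 + 14 * t ^ 2 - 7 = 0) (h7 : a * a' = 7)
    (ha : Algebra.norm ℤ a = 7 ^ 6) (ha' : Algebra.norm ℤ a' = 7 ^ 6) :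
    (Algebra.norm ℤ t).natAbs = 49 := by
  have hu : IsUnit (t ^ 2 - 1) := IsUnit.of_mul_eq_one (-(t ^ 4 - 6 * t ^ 2 + 8)) <| by
    linear_combination -ht
  have hu' := Int.isUnit_sq (hu.map (Algebra.norm ℤ))
  have ht6 : t ^ 6 = a * a' * (t ^ 2 - 1) ^ 2 := by
    linear_combination ht - (t ^ 2 - 1) ^ 2 * h7
  have h1 := congrArg (fun x => (Algebra.norm ℤ x).natAbs) ht6
  simp only [map_mul, map_pow, ha, ha', hu', Int.natAbs_pow] at h1
  exact Nat.pow_left_injective (n := 6) (by norm_num) (h1.trans (by norm_num))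

variable [NumberField K]

/-- A prime containing the factor `a` of `7 = a a'` contains it to the sixth power, because
`t ^ 6 = 7 (t ^ 2 - 1) ^ 2`. -/
theorem pow_six_dvd_span (ht : t ^ 6 - 7 * t ^ 4 + 14 * t ^ 2 - 7 = 0) (h7 : a * a' = 7)
    (h5 : a + a' = 5) (P : Ideal (𝓞 K)) [hP : P.IsPrime] (ha : a ∈ P) :
    t ∈ P ∧ P ^ 6 ∣ Ideal.span {a} := by
  have h7P : (7 : 𝓞 K) ∈ P := h7 ▸ P.mul_mem_right a' ha
  have ht6 : t ^ 6 = a * (a' * (t ^ 2 - 1) ^ 2) := by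
    linear_combination ht - (t ^ 2 - 1) ^ 2 * h7
  have htP : t ∈ P := hP.mem_of_pow_mem 6 (ht6 ▸ P.mul_mem_right _ ha)
  refine ⟨htP, ?_⟩
  have hnot : a' * (t ^ 2 - 1) ^ 2 ∉ P := by
    intro h
    apply hP.one_notMem
    rcases hP.mem_or_mem h with h | h
    -- `1 = 3 · 5 - 2 · 7` shows that `a` and `a'` cannot both lie in `P`.
    · have : (1 : 𝓞 K) = 3 * (a + a') - 2 * 7 := by rw [h5]; norm_num
      rw [this]
      exact P.sub_mem (P.mul_mem_left _ (P.add_mem ha h)) (P.mul_mem_left _ h7P)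
    · have : (1 : 𝓞 K) = t * t - (t ^ 2 - 1) := by ring
      rw [this]
      exact P.sub_mem (P.mul_mem_left _ htP) (hP.mem_of_pow_mem 2 h)
  have hmax : P.IsMaximal := hP.isMaximal fun h => by
    rw [h] at h7P
    simp at h7P
  have hcop : IsCoprime P (Ideal.span {a' * (t ^ 2 - 1) ^ 2}) := by
    rw [Ideal.isCoprime_iff_sup_eq]
    exact hmax.1.2 _ (lt_of_le_of_ne le_sup_left fun h => hnot <| by
      rw [h]
      exact Ideal.mem_sup_right (Ideal.mem_span_singleton_self _))
  refine hcop.pow_left.dvd_of_dvd_mul_right ?_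
  rw [Ideal.span_singleton_mul_span_singleton, ← ht6, ← Ideal.span_singleton_pow]
  exact pow_dvd_pow_of_dvd ((Ideal.dvd_span_singleton).mpr htP) 6

variable {r : ℕ}

/-- If `P` has norm `7^s`, then `P^6 ∣ (a)` gives `6 s ≤ r ≤ 6` with `s ≥ 1`. This also forces the
degree `r` to be `6`. -/
theorem absNorm_eq_seven (ht : t ^ 6 - 7 * t ^ 4 + 14 * t ^ 2 - 7 = 0) (h7 : a * a' = 7)
    (h5 : a + a' = 5) (hnorm : Algebra.norm ℤ a = 7 ^ r) (hr : r ≤ 6) (P : Ideal (𝓞 K))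
    [hP : P.IsPrime] (ha : a ∈ P) : r = 6 ∧ Ideal.absNorm P = 7 := by
  have h1 := map_dvd Ideal.absNorm (pow_six_dvd_span ht h7 h5 P ha).2
  rw [map_pow, Ideal.absNorm_span_singleton, hnorm, Int.natAbs_pow,
    show Int.natAbs 7 = 7 from rfl] at h1
  obtain ⟨s, -, hs⟩ :=
    (Nat.dvd_prime_pow (by norm_num)).mp ((dvd_pow_self _ (by norm_num)).trans h1)
  rw [hs, ← pow_mul, Nat.pow_dvd_pow_iff_le_right (by norm_num)] at h1
  have hs0 : s ≠ 0 := by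
    rintro rfl
    exact hP.ne_top (Ideal.absNorm_eq_one_iff.mp hs)
  refine ⟨by omega, ?_⟩
  rw [hs, show s = 1 by omega, pow_one]

/-- Two distinct primes would contribute norm `7^12` to an ideal of norm `7^6`. -/
theorem eq_of_mem_prime (ht : t ^ 6 - 7 * t ^ 4 + 14 * t ^ 2 - 7 = 0) (h7 : a * a' = 7)
    (h5 : a + a' = 5) (hnorm : Algebra.norm ℤ a = 7 ^ r) (hr : r ≤ 6) (P Q : Ideal (𝓞 K))
    [hP : P.IsPrime] [hQ : Q.IsPrime] (haP : a ∈ P) (haQ : a ∈ Q) : Q = P := by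
  by_contra hne
  obtain ⟨hr6, hPn⟩ := absNorm_eq_seven ht h7 h5 hnorm hr P haP
  have hQn := (absNorm_eq_seven ht h7 h5 hnorm hr Q haQ).2
  have hmax (R : Ideal (𝓞 K)) [hR : R.IsPrime] (hRn : Ideal.absNorm R = 7) : R.IsMaximal :=
    hR.isMaximal fun h => by simp [h] at hRn
  have hcop : IsCoprime (Q ^ 6) (P ^ 6) :=
    have := hmax Q hQn
    have := hmax P hPn
    (Ideal.isCoprime_of_isMaximal hne).pow
  have h1 := map_dvd Ideal.absNorm (hcop.mul_dvd (pow_six_dvd_span ht h7 h5 Q haQ).2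
    (pow_six_dvd_span ht h7 h5 P haP).2)
  rw [map_mul, map_pow, map_pow, hPn, hQn, Ideal.absNorm_span_singleton, hnorm, hr6] at h1
  norm_num at h1

theorem exists_int_sub_mem {P : Ideal (𝓞 K)} (hP : Ideal.absNorm P = 7) (x : 𝓞 K) :
    ∃ m : ℤ, x - m ∈ P := by
  have hcard : Nat.card (𝓞 K ⧸ P) = 7 := by
    rw [← hP, Ideal.absNorm_apply, Submodule.cardQuot_apply]
  have : Finite (𝓞 K ⧸ P) := Nat.finite_of_card_ne_zero (by omega)
  have : Fintype (𝓞 K ⧸ P) := Fintype.ofFinite _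
  let e := ZMod.ringEquivOfPrime (𝓞 K ⧸ P) (p := 7) (by norm_num)
    (by rw [← Nat.card_eq_fintype_card, hcard])
  refine ⟨((e.symm (Ideal.Quotient.mk P x)).val : ℕ), ?_⟩
  rw [← Ideal.Quotient.eq_zero_iff_mem, map_sub, map_intCast, Int.cast_natCast, sub_eq_zero]
  conv_lhs => rw [← e.apply_symm_apply (Ideal.Quotient.mk P x)]
  conv_lhs => rw [← ZMod.natCast_zmod_val (e.symm (Ideal.Quotient.mk P x)), map_natCast]

/-- As `P` is the only prime containing `a`, it is stable under `τ`; every class modulo `P` contains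
an integer, which `τ` fixes. -/
theorem sub_mem_of_apply_eq (ht : t ^ 6 - 7 * t ^ 4 + 14 * t ^ 2 - 7 = 0) (h7 : a * a' = 7)
    (h5 : a + a' = 5) (hnorm : Algebra.norm ℤ a = 7 ^ r) (hr : r ≤ 6) (P : Ideal (𝓞 K))
    [hP : P.IsPrime] (ha : a ∈ P) (τ : 𝓞 K ≃+* 𝓞 K) (hτ : τ a = a) (x : 𝓞 K) : τ x - x ∈ P := by
  have hcomap : P.comap τ = P :=
    eq_of_mem_prime ht h7 h5 hnorm hr P (P.comap τ) ha (by simpa [Ideal.mem_comap, hτ] using ha)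
  obtain ⟨m, hm⟩ := exists_int_sub_mem (absNorm_eq_seven ht h7 h5 hnorm hr P ha).2 x
  have hm' : x - m ∈ P.comap τ := hcomap.symm ▸ hm
  rw [Ideal.mem_comap, map_sub, map_intCast] at hm'
  have := P.sub_mem hm' hm
  rwa [sub_sub_sub_cancel_right] at this

end PrimeAboveSeven

/-! ### Division property of the six-dimensional algebra -/

section RelativeExtension

variable {F K : Type*} [Field F] [NumberField F] [Field K] [NumberField K] [Algebra F K]

/-- The arithmetic of a prime ideal above `7` in `ℚ(j, θ)`. -/
theorem prime_above_seven {j : 𝓞 F} (hj : j ^ 2 + j + 1 = 0)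
    (hN1 : Algebra.norm ℤ (3 + j) = 7) (hN2 : Algebra.norm ℤ (2 - j) = 7) {t : 𝓞 K}
    (ht : t ^ 6 - 7 * t ^ 4 + 14 * t ^ 2 - 7 = 0) (hr : Module.finrank F K ≤ 6)
    (P : Ideal (𝓞 K)) [hP : P.IsPrime] (hP7 : 7 ∈ P) :
    Module.finrank F K = 6 ∧ Ideal.absNorm P = 7 ∧ t ∈ P ∧ (Algebra.norm ℤ t).natAbs = 49 ∧
      ∀ (σ : K ≃ₐ[F] K) (x : Fin 6 → K), x ≠ 0 →
        (leftMulMatrix σ ((-j : 𝓞 F) : F) x).det ≠ 0 := by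
  let A := algebraMap (𝓞 F) (𝓞 K)
  have h7 : A (3 + j) * A (2 - j) = 7 := by
    rw [← map_mul, show (3 + j) * (2 - j) = 7 by linear_combination -hj, map_ofNat]
  have h5 : A (3 + j) + A (2 - j) = 5 := by
    rw [← map_add, show (3 + j) + (2 - j) = 5 by ring, map_ofNat]
  -- The factors `3 + j` and `2 - j` of `7` play symmetric roles; `P` contains one of them.
  have key (d d' : 𝓞 F) (h7 : A d * A d' = 7) (h5 : A d + A d' = 5) (hN : Algebra.norm ℤ d = 7)
      (hN' : Algebra.norm ℤ d' = 7) (hd : A d ∈ P) :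
      Module.finrank F K = 6 ∧ Ideal.absNorm P = 7 ∧ t ∈ P ∧ (Algebra.norm ℤ t).natAbs = 49 ∧
        ∀ (σ : K ≃ₐ[F] K) (x : 𝓞 K), RingOfIntegers.mapRingEquiv σ.toRingEquiv x - x ∈ P := by
    have hn (e : 𝓞 F) (he : Algebra.norm ℤ e = 7) :
        Algebra.norm ℤ (A e) = 7 ^ Module.finrank F K := by
      rw [norm_algebraMap_eq_pow, he]
    obtain ⟨h6, hPn⟩ := absNorm_eq_seven ht h7 h5 (hn d hN) hr P hd
    refine ⟨h6, hPn, (pow_six_dvd_span ht h7 h5 P hd).1,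
      natAbs_norm_eq ht h7 (h6 ▸ hn d hN) (h6 ▸ hn d' hN'), fun σ x => ?_⟩
    refine sub_mem_of_apply_eq ht h7 h5 (hn d hN) hr P hd _ ?_ x
    exact RingOfIntegers.coe_injective (σ.commutes (d : F))
  have hmain : Module.finrank F K = 6 ∧ Ideal.absNorm P = 7 ∧ t ∈ P ∧
      (Algebra.norm ℤ t).natAbs = 49 ∧
        ∀ (σ : K ≃ₐ[F] K) (x : 𝓞 K), RingOfIntegers.mapRingEquiv σ.toRingEquiv x - x ∈ P := by
    rcases hP.mem_or_mem (h7 ▸ hP7 : A (3 + j) * A (2 - j) ∈ P) with h | h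
    · exact key _ _ h7 h5 hN1 hN2 h
    · exact key _ _ ((mul_comm _ _).trans h7) ((add_comm _ _).trans h5) hN2 hN1 h
  obtain ⟨h6, hPn, htP, htn, hσ⟩ := hmain
  refine ⟨h6, hPn, htP, htn, fun σ x hx => ?_⟩
  have hmax : P.IsMaximal := hP.isMaximal fun h => by simp [h] at hPn
  let : Field (𝓞 K ⧸ P) := Ideal.Quotient.field P
  have hcard : Nat.card (𝓞 K ⧸ P) = 7 := by
    rw [← hPn, Ideal.absNorm_apply, Submodule.cardQuot_apply]
  obtain ⟨α, hα, hli⟩ := exists_pow_six_eq_linearIndependent hcard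
    (g := Ideal.Quotient.mk P (A (-j))) <| by
      rw [← map_pow, ← map_sub, ← map_one (Ideal.Quotient.mk P), ← map_add, ← map_pow, ← map_sub,
        ← map_one A, ← map_add, show (-j) ^ 2 - -j + 1 = 0 by linear_combination hj, map_zero,
        map_zero]
  exact det_leftMulMatrix_ne_zero_of_residue (π := Ideal.Quotient.mk P)
    (fun x => Ideal.Quotient.eq.mpr (hσ σ x)) hα hli x hx

end RelativeExtension

/-! ### The field generated by `2 cos (π / 14)` -/

open Polynomial in
theorem thetaSix_poly : thetaSix ^ 6 - 7 * thetaSix ^ 4 + 14 * thetaSix ^ 2 - 7 = 0 := by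
  set x := Real.cos (Real.pi / 14) with hx
  have hpos : 0 < x :=
    Real.cos_pos_of_mem_Ioo ⟨by linarith [Real.pi_pos], by linarith [Real.pi_pos]⟩
  have h7 : Real.cos (7 * (Real.pi / 14)) = 0 := by
    rw [← Real.cos_pi_div_two]; ring_nf
  have hT := Chebyshev.T_real_cos (Real.pi / 14) 7
  push_cast at hT
  rw [h7, ← hx, show (7 : ℤ) = 5 + 2 by norm_num, Chebyshev.T_add_two,
    show (5 : ℤ) + 1 = 4 + 2 by norm_num, Chebyshev.T_add_two, show (4 : ℤ) + 1 = 3 + 2 by norm_num,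
    show (5 : ℤ) = 3 + 2 by norm_num, Chebyshev.T_add_two, show (4 : ℤ) = 2 + 2 by norm_num,
    Chebyshev.T_add_two, show (3 : ℤ) + 1 = 2 + 2 by norm_num, Chebyshev.T_add_two,
    show (2 : ℤ) + 1 = 1 + 2 by norm_num, show (3 : ℤ) = 1 + 2 by norm_num,
    Chebyshev.T_add_two, show (1 : ℤ) + 1 = 2 by norm_num, Chebyshev.T_two, Chebyshev.T_one] at hT
  simp at hT
  -- The Chebyshev polynomial `T₇(x)` is `x` times this polynomial in `2x`, and `T₇(x) = cos (π / 2)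
  -- = 0`.
  have hreal : (2 * x) ^ 6 - 7 * (2 * x) ^ 4 + 14 * (2 * x) ^ 2 - 7 = 0 := by
    apply mul_left_cancel₀ hpos.ne'
    linear_combination hT
  rw [thetaSix, ← hx]
  exact_mod_cast congrArg (fun y : ℝ => (y : ℂ)) hreal

instance : NumberField baseSix where
  to_charZero := inferInstance
  to_finiteDimensional := Module.finite_of_finrank_pos <| by
    rw [finrank_adjoin_eq_two (a := 1) (b := 1) zetaThree_im_ne_zero (by simpa using zetaThree_sq)]
    norm_num

open Polynomial in
/-- The minimal polynomial of `θ`. -/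
noncomputable def thetaPoly (k : Type*) [Field k] : k[X] := X ^ 6 - 7 * X ^ 4 + 14 * X ^ 2 - 7

theorem thetaPoly_monic (k : Type*) [Field k] : (thetaPoly k).Monic := by
  rw [thetaPoly]
  monicity!

theorem thetaPoly_natDegree (k : Type*) [Field k] : (thetaPoly k).natDegree = 6 := by
  rw [thetaPoly]
  compute_degree!

open Polynomial in
/-- The conjugates of `θ = 2 cos a` are `± θ`, `± 2 cos 3a` and `± 2 cos 5a`. -/
theorem thetaPoly_eq_prod {k : Type*} [Field k] {t : k}
    (ht : t ^ 6 - 7 * t ^ 4 + 14 * t ^ 2 - 7 = 0) :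
    thetaPoly k = (X - C t) * (X - C (-t)) * ((X - C (t ^ 3 - 3 * t)) * (X - C (-(t ^ 3 - 3 * t)))) *
      ((X - C (t ^ 5 - 5 * t ^ 3 + 5 * t)) * (X - C (-(t ^ 5 - 5 * t ^ 3 + 5 * t)))) := by
  have hC : (C t : k[X]) ^ 6 - 7 * C t ^ 4 + 14 * C t ^ 2 - 7 = 0 := by
    have := congrArg (C : k → k[X]) ht
    simpa [C_ofNat] using this
  simp only [thetaPoly, map_sub, map_mul, map_pow, map_add, map_neg, C_ofNat]
  generalize (C t : k[X]) = u at hC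
  -- The coefficients are the quotients by `u^6 - 7u^4 + 14u^2 - 7` of the coefficients in `X` of
  -- the difference of the two sides.
  linear_combination ((u ^ 4 - 3 * u ^ 2 + 1) * X ^ 4 +
    (-u ^ 10 + 9 * u ^ 8 - 28 * u ^ 6 + 31 * u ^ 4 - 4 * u ^ 2 - 2) * X ^ 2 +
    (u ^ 12 - 9 * u ^ 10 + 27 * u ^ 8 - 28 * u ^ 6 + 3 * u ^ 4 + 2 * u ^ 2 + 1)) * hC

/-- All roots of the sextic are polynomials in `θ`, so `k(θ)` is its splitting field. The bound `≤
6` suffices; over `ℚ(j)` equality follows from ramification above `7`. -/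
theorem finiteDimensional_finrank_le_isGalois {k E : Type*} [Field k] [CharZero k] [Field E]
    [Algebra k E] {θ : E} (h : θ ^ 6 - 7 * θ ^ 4 + 14 * θ ^ 2 - 7 = 0) :
    FiniteDimensional k k⟮θ⟯ ∧ Module.finrank k k⟮θ⟯ ≤ 6 ∧ IsGalois k k⟮θ⟯ := by
  have h0 : Polynomial.aeval θ (thetaPoly k) = 0 := by simpa [thetaPoly, map_ofNat] using h
  have hint : IsIntegral k θ := ⟨_, thetaPoly_monic k, by simpa [Polynomial.aeval_def] using h0⟩
  have hfin : FiniteDimensional k k⟮θ⟯ := adjoin.finiteDimensional hint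
  refine ⟨hfin, ?_, ?_⟩
  · rw [adjoin.finrank hint, ← thetaPoly_natDegree k]
    exact Polynomial.natDegree_le_natDegree (minpoly.min k θ (thetaPoly_monic k) h0)
  · let t : k⟮θ⟯ := AdjoinSimple.gen k θ
    have ht : t ^ 6 - 7 * t ^ 4 + 14 * t ^ 2 - 7 = 0 := by
      apply (algebraMap k⟮θ⟯ E).injective
      rw [map_sub, map_add, map_sub, map_mul, map_mul]
      simp only [map_pow, map_ofNat, map_zero]
      exact h
    have hmap : (thetaPoly k).map (algebraMap k k⟮θ⟯) = thetaPoly k⟮θ⟯ := by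
      simp [thetaPoly]
    have hsplit : ((thetaPoly k).map (algebraMap k k⟮θ⟯)).Splits := by
      rw [hmap, thetaPoly_eq_prod ht]
      have hX (u : k⟮θ⟯) := Polynomial.Splits.X_sub_C u
      exact (((hX _).mul (hX _)).mul ((hX _).mul (hX _))).mul ((hX _).mul (hX _))
    have hadj : k⟮θ⟯ = adjoin k ((thetaPoly k).rootSet E) := by
      have hθ : θ ∈ k⟮θ⟯ := mem_adjoin_simple_self k θ
      have h3 : θ ^ 3 - 3 * θ ∈ k⟮θ⟯ :=
        sub_mem (pow_mem hθ 3) (mul_mem (ofNat_mem _ 3) hθ)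
      have h5 : θ ^ 5 - 5 * θ ^ 3 + 5 * θ ∈ k⟮θ⟯ :=
        add_mem (sub_mem (pow_mem hθ 5) (mul_mem (ofNat_mem _ 5) (pow_mem hθ 3)))
          (mul_mem (ofNat_mem _ 5) hθ)
      refine le_antisymm (adjoin_simple_le_iff.mpr (subset_adjoin k _ ?_))
        (adjoin_le_iff.mpr fun x hx => ?_)
      · exact (Polynomial.mem_rootSet_of_ne (thetaPoly_monic k).ne_zero).mpr h0
      · have hx0 := (Polynomial.mem_rootSet_of_ne (thetaPoly_monic k).ne_zero).mp hx
        have hx1 : (thetaPoly E).eval x = 0 := by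
          simpa [thetaPoly, map_ofNat] using hx0
        rw [thetaPoly_eq_prod h] at hx1
        simp only [Polynomial.eval_mul, Polynomial.eval_sub, Polynomial.eval_X, Polynomial.eval_C,
          mul_eq_zero, sub_eq_zero] at hx1
        rcases hx1 with ((rfl | rfl) | rfl | rfl) | rfl | rfl
        exacts [hθ, neg_mem hθ, h3, neg_mem h3, h5, neg_mem h5]
    have : (thetaPoly k).IsSplittingField k k⟮θ⟯ := isSplittingField_iff.mpr ⟨hsplit, hadj⟩
    have : Normal k k⟮θ⟯ := Normal.of_isSplittingField (thetaPoly k)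
    exact ⟨⟩

instance : FiniteDimensional baseSix fieldSix :=
  (finiteDimensional_finrank_le_isGalois thetaSix_poly).1

instance : IsGalois baseSix fieldSix :=
  (finiteDimensional_finrank_le_isGalois thetaSix_poly).2.2

instance : NumberField fieldSix where
  to_charZero := inferInstance
  to_finiteDimensional := by
    have : FiniteDimensional ℚ fieldSix := FiniteDimensional.trans ℚ baseSix fieldSix
    convert this

/-! ### The six-by-six code -/

theorem sixCode_bounds (σ : fieldSix ≃ₐ[baseSix] fieldSix) (I : Ideal (𝓞 fieldSix))
    (hgen : ∀ τ : fieldSix ≃ₐ[baseSix] fieldSix, τ ∈ Subgroup.zpowers σ) (hI : I.IsPrime)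
    (h7 : 7 ∈ I) :
    ∃ δ : ℝ, IsMinDet (infiniteCode 6 σ gammaSix I 14) δ ∧
      1 / (2 ^ 6 * 7 ^ 5) ≤ δ ∧ δ ≤ 1 / (2 ^ 6 * 7 ^ 4) := by
  have hgen3 : (AdjoinSimple.gen ℚ zetaThree) ^ 2 + AdjoinSimple.gen ℚ zetaThree + 1 = 0 :=
    Subtype.ext zetaThree_sq
  have hint : IsIntegral ℤ (AdjoinSimple.gen ℚ zetaThree) :=
    ⟨Polynomial.X ^ 2 + Polynomial.X + 1, by monicity!, by simpa using hgen3⟩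
  let j : 𝓞 baseSix := ⟨_, hint⟩
  have hj : j ^ 2 + j + 1 = 0 := RingOfIntegers.coe_injective hgen3
  have hre : zetaThree.re = -1 / 2 ∧ zetaThree.im ^ 2 = 3 / 4 := by
    have h1 := congrArg Complex.re zetaThree_sq
    have h2 := congrArg Complex.im zetaThree_sq
    simp [sq] at h1 h2
    have h3 : zetaThree.re = -1 / 2 := by
      apply mul_left_cancel₀ zetaThree_im_ne_zero
      linear_combination h2 / 2
    exact ⟨h3, by rw [h3] at h1; linear_combination -h1⟩
  have hnorm (d : 𝓞 baseSix) (hd : ‖((d : baseSix) : ℂ)‖ ^ 2 = 7) : Algebra.norm ℤ d = 7 := by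
    have := norm_baseSix d
    rw [hd, ← Algebra.coe_norm_int] at this
    exact_mod_cast this
  have hN1 : Algebra.norm ℤ (3 + j) = 7 := hnorm _ <| by
    change ‖3 + zetaThree‖ ^ 2 = 7
    rw [Complex.sq_norm, Complex.normSq_apply]
    simp
    nlinarith [hre.1, hre.2]
  have hN2 : Algebra.norm ℤ (2 - j) = 7 := hnorm _ <| by
    change ‖2 - zetaThree‖ ^ 2 = 7
    rw [Complex.sq_norm, Complex.normSq_apply]
    simp
    nlinarith [hre.1, hre.2]
  let θ' : fieldSix := AdjoinSimple.gen baseSix thetaSix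
  have hθ' : θ' ^ 6 - 7 * θ' ^ 4 + 14 * θ' ^ 2 - 7 = 0 := Subtype.ext thetaSix_poly
  let t : 𝓞 fieldSix := ⟨θ', ⟨Polynomial.X ^ 6 - 7 * Polynomial.X ^ 4 + 14 * Polynomial.X ^ 2 - 7,
    by monicity!, by simpa using hθ'⟩⟩
  have ht : t ^ 6 - 7 * t ^ 4 + 14 * t ^ 2 - 7 = 0 := RingOfIntegers.coe_injective hθ'
  obtain ⟨h6, hIn, htI, htn, hdiv⟩ := prime_above_seven hj hN1 hN2 ht
    (finiteDimensional_finrank_le_isGalois thetaSix_poly).2.1 I h7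
  have hσ : σ ^ 6 = 1 := by
    rw [← h6, ← IsGalois.card_aut_eq_finrank]
    exact pow_card_eq_one'
  have ht0 : t ≠ 0 := by
    intro h
    simp [h] at htn
  have hγ0 : gammaSix ≠ 0 := by
    intro h
    have h' : AdjoinSimple.gen ℚ zetaThree = 0 := neg_eq_zero.mp h
    rw [h'] at hgen3
    simp at hgen3
  have hI0 : I ≠ ⊥ := by
    intro h
    rw [h] at htI
    exact ht0 (by simpa using htI)
  obtain ⟨δ, hδ, hlow, hup⟩ := exists_isMinDet (γ := gammaSix) (I := I) (c := 14) norm_baseSix h6 hσ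
    hgen hint.neg hγ0 hI0 (by norm_num) (hdiv σ)
  refine ⟨δ, hδ, ?_, ?_⟩
  · rw [hIn] at hlow
    -- The lower bound is `7 / 14^6`.
    exact le_trans (by norm_num) hlow
  · have h49 : ((Algebra.norm ℚ (t : fieldSix) : ℚ) : ℝ) = 49 := by
      have h := norm_eq_sq_norm_norm (φ := algebraMap fieldSix ℂ) norm_baseSix (t : fieldSix)
      rw [← Algebra.coe_norm_int, Rat.cast_intCast] at h ⊢
      have h0 : 0 ≤ Algebra.norm ℤ t := by
        have : (0 : ℝ) ≤ (Algebra.norm ℤ t : ℤ) := h ▸ by positivity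
        exact_mod_cast this
      have : Algebra.norm ℤ t = 49 := by omega
      rw [this]
      norm_num
    have := hup t htI ht0
    rw [h49] at this
    -- The element `θ` of `I` has norm `49`, so the upper bound is `49 / 14^6`.
    exact this.trans (by norm_num)

end PerfectCode

theorem mainTheorem9 :
    (∀ (F : IntermediateField ℚ ℂ) [NumberField F] (θ : ℂ) [NumberField ℚ⟮θ⟯]
      (K : IntermediateField F ℂ) [NumberField K] (n : ℕ) [NeZero n] (σ : K ≃ₐ[F] K) (γ : F)
      (I : Ideal (𝓞 K)) (ν : Module.Basis (Fin n) (𝓞 F) I) (c : ℝ),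
      PerfectCode.IsPerfectCode θ σ γ ν c →
        ∃ δ m : ℝ,
          PerfectCode.IsMinDet (PerfectCode.infiniteCode n σ γ I c) δ ∧
          PerfectCode.IsMinNorm I m ∧
          (Ideal.absNorm I : ℝ) / PerfectCode.complexLatticeVol σ ν
            = 1 / (discr ℚ⟮θ⟯ : ℝ) ∧
          1 / (discr ℚ⟮θ⟯ : ℝ) ≤ δ ∧
          δ ≤ 1 / PerfectCode.complexLatticeVol σ ν * m) ∧
    (∀ (σ : PerfectCode.fieldSix ≃ₐ[PerfectCode.baseSix] PerfectCode.fieldSix)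
      (I : Ideal (𝓞 PerfectCode.fieldSix)),
      (∀ τ : PerfectCode.fieldSix ≃ₐ[PerfectCode.baseSix] PerfectCode.fieldSix,
        τ ∈ Subgroup.zpowers σ) → I.IsPrime → 7 ∈ I →
        ∃ δ : ℝ,
          PerfectCode.IsMinDet
            (PerfectCode.infiniteCode 6 σ PerfectCode.gammaSix I 14) δ ∧
          1 / (2 ^ 6 * 7 ^ 5) ≤ δ ∧ δ ≤ 1 / (2 ^ 6 * 7 ^ 4)) :=
  ⟨fun _ _ _ _ _ _ _ _ _ _ _ _ _ h => PerfectCode.perfectCode_bounds h,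
    PerfectCode.sixCode_bounds⟩
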